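/- Let $n\ge 1$ and let $\mathfrak p(n)$ be the periplectic Lie superalgebra over $\mathbb C$ of all block matrices $\begin{bmatrix}A&B\\C&-A^t\end{bmatrix}$ ($n\times n$ blocks) with $B^t=B$, $C^t=-C$. Let $V=P_{n|n}=\mathbb C^{n|n}$ be its standard module, with even basis $x_1,\dots,x_n$ and odd basis $\xi_1,\dots,\xi_n$, so that $S^\bullet V=\mathbb C[x_1,\dots,x_n,\xi_1,\dots,\xi_n]$, and let $$q=\sum_{i=1}^n\frac{\partial^2}{\partial x_i\,\partial\xi_i}\colon S^dV\to S^{d-2}V$$ be the contraction with the odd $\mathfrak p(n)$-invariant form on $V$ that pairs $x_i$ with $\xi_i$. Let $\epsilon_1,\dots,\epsilon_n$ be the standard coordinates on the Cartan subalgebra of diagonal matrices (so $x_i$ has weight $\epsilon_i$ and $\xi_i$ has weight $-\epsilon_i$), and $\omega=\epsilon_1+\dots+\epsilon_n$. Let $\mathfrak b$ be the Borel subalgebra of all $\begin{bmatrix}A&B\\0&-A^t\end{bmatrix}$ with $A$ upper triangular and $B$ symmetric; its positive roots are $\epsilon_i-\epsilon_j$ $(i<j)$ and $\epsilon_i+\epsilon_j$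 $(i\le j)$. Write $L(\lambda)$ for the finite-dimensional simple $\mathfrak p(n)$-module of highest weight $\lambda$ with respect to $\mathfrak b$ whose highest weight vector is even, and $\Pi$ for the parity shift. Submodules are $\mathbb Z/2$-graded and isomorphisms are even. Then $S^0V$ is the trivial module $\mathbb C$, $S^1V\cong V$, and for every $d\ge 2$: 1. If $d\ne n$, then the socle filtration of $S^dV$ has exactly two layers: the socle is isomorphic to $L(d\epsilon_1)$, and the quotient of $S^dV$ by its socle is isomorphic to $\Pi L((d-2)\epsilon_1)$. 2. If $d=n$, then the socle filtration of $S^nV$ has exactly three layers, which are, from the socle to the top, isomorphic to $L(n\epsilon_1)$, $\Pi^nL(-\omega)$ and $\Pi L((n-2)\epsilon_1)$. In both cases the radical of $S^dV$ (the intersection of its maximal submodules) is equal to $\ker(q\colon S^dV\to S^{d-2}V)$, and the head $S^dV/\operatorname{rad}S^dV$ is isomorphic to $\Pi L((d-2)\epsilon_1)$. -/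

import Mathlib

open scoped TensorProduct

noncomputable section

namespace SuperLie

/-! ### Super vector spaces, Lie superalgebras and their modules over `ℂ` -/

/-- The Koszul sign `(-1)^{ij}` for parities `i, j ∈ ℤ/2`. -/
def koszul (i j : ZMod 2) : ℂ := if i = 1 ∧ j = 1 then -1 else 1

/-- A complex Lie superalgebra `𝔤 = 𝔤₀ ⊕ 𝔤₁`. -/
structure LieSuperalgebra where
  carrier : Type
  [addCommGroup : AddCommGroup carrier]
  [module : Module ℂ carrier]
  /-- the homogeneous parts -/
  gr : ZMod 2 → Submodule ℂ carrier
  isCompl : IsCompl (gr 0) (gr 1)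
  /-- the superbracket -/
  br : carrier →ₗ[ℂ] carrier →ₗ[ℂ] carrier
  br_mem : ∀ i j : ZMod 2, ∀ x ∈ gr i, ∀ y ∈ gr j, br x y ∈ gr (i + j)
  br_skew : ∀ i j : ZMod 2, ∀ x ∈ gr i, ∀ y ∈ gr j, br x y = -(koszul i j • br y x)
  jacobi : ∀ i j : ZMod 2, ∀ x ∈ gr i, ∀ y ∈ gr j, ∀ z : carrier,
    br x (br y z) = br (br x y) z + koszul i j • br y (br x z)

attribute [instance] LieSuperalgebra.addCommGroup LieSuperalgebra.module

/-- A module over a Lie superalgebra `𝔤`: a super vector space `M = M₀ ⊕ M₁` with a parity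
preserving action `ρ`, such that `ρ [x,y] = ρ x ρ y - (-1)^{|x||y|} ρ y ρ x`. -/
structure SuperModule (𝔤 : LieSuperalgebra) where
  carrier : Type
  [addCommGroup : AddCommGroup carrier]
  [module : Module ℂ carrier]
  gr : ZMod 2 → Submodule ℂ carrier
  isCompl : IsCompl (gr 0) (gr 1)
  ρ : 𝔤.carrier →ₗ[ℂ] Module.End ℂ carrier
  ρ_mem : ∀ i j : ZMod 2, ∀ x ∈ 𝔤.gr i, ∀ v ∈ gr j, ρ x v ∈ gr (i + j)
  ρ_br : ∀ i j : ZMod 2, ∀ x ∈ 𝔤.gr i, ∀ y ∈ 𝔤.gr j,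
    ρ (𝔤.br x y) = ρ x * ρ y - koszul i j • (ρ y * ρ x)

attribute [instance] SuperModule.addCommGroup SuperModule.module

namespace SuperModule

variable {𝔤 : LieSuperalgebra}

/-- `M ≅ N`: there is an even `𝔤`-equivariant linear isomorphism. -/
def Isomorphic (M N : SuperModule 𝔤) : Prop :=
  ∃ e : M.carrier ≃ₗ[ℂ] N.carrier,
    (∀ i : ZMod 2, ∀ v ∈ M.gr i, e v ∈ N.gr i) ∧
    ∀ (x : 𝔤.carrier) (v : M.carrier), e (M.ρ x v) = N.ρ x (e v)

/-- The parity involution `v ↦ (-1)^{|v|} v`. -/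
def parityInv (M : SuperModule 𝔤) : Module.End ℂ M.carrier :=
  (M.gr 0).projection (M.gr 1) M.isCompl - (M.gr 1).projection (M.gr 0) M.isCompl.symm

theorem parityInv_zero (M : SuperModule 𝔤) {v : M.carrier} (hv : v ∈ M.gr 0) :
    M.parityInv v = v := by
  have h1 := Submodule.projection_apply_left M.isCompl ⟨v, hv⟩
  have h2 := Submodule.projection_apply_right M.isCompl.symm ⟨v, hv⟩
  simp only at h1 h2
  simp [parityInv, h1, h2]

theorem parityInv_one (M : SuperModule 𝔤) {v : M.carrier} (hv : v ∈ M.gr 1) :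
    M.parityInv v = -v := by
  have h1 := Submodule.projection_apply_left M.isCompl.symm ⟨v, hv⟩
  have h2 := Submodule.projection_apply_right M.isCompl ⟨v, hv⟩
  simp only at h1 h2
  simp [parityInv, h1, h2]

theorem exists_add (M : SuperModule 𝔤) (v : M.carrier) :
    ∃ a ∈ M.gr 0, ∃ b ∈ M.gr 1, v = a + b := by
  have : v ∈ M.gr 0 ⊔ M.gr 1 := by rw [M.isCompl.sup_eq_top]; trivial
  obtain ⟨a, ha, b, hb, h⟩ := Submodule.mem_sup.1 this
  exact ⟨a, ha, b, hb, h.symm⟩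

theorem parityInv_sq (M : SuperModule 𝔤) : M.parityInv * M.parityInv = 1 := by
  ext v
  obtain ⟨a, ha, b, hb, rfl⟩ := M.exists_add v
  simp [M.parityInv_zero ha, M.parityInv_one hb]

theorem parityInv_mem (M : SuperModule 𝔤) (i : ZMod 2) {v : M.carrier} (hv : v ∈ M.gr i) :
    M.parityInv v ∈ M.gr i := by
  fin_cases i
  · have h : v ∈ M.gr 0 := hv
    rw [M.parityInv_zero h]; exact hv
  · have h : v ∈ M.gr 1 := hv
    rw [M.parityInv_one h]; exact neg_mem hv

/-- The parity shift `Π M = ℂ^{0|1} ⊗ M`: parities are exchanged, and a homogeneous `x ∈ 𝔤` acts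
by `(-1)^{|x|} ρ x` (which is the conjugate of `ρ x` by the parity involution). -/
def parityShift (M : SuperModule 𝔤) : SuperModule 𝔤 where
  carrier := M.carrier
  gr i := M.gr (i + 1)
  isCompl := by
    have h : (1 + 1 : ZMod 2) = 0 := by decide
    rw [zero_add, h]; exact M.isCompl.symm
  ρ := (LinearMap.mulLeft ℂ M.parityInv ∘ₗ LinearMap.mulRight ℂ M.parityInv) ∘ₗ M.ρ
  ρ_mem := by
    intro i j x hx v hv
    have := M.parityInv_mem _ (M.ρ_mem i (j + 1) x hx _ (M.parityInv_mem _ hv))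
    rw [← add_assoc] at this
    simpa using this
  ρ_br := by
    intro i j x hx y hy
    have key : ∀ a b : Module.End ℂ M.carrier,
        (M.parityInv * (a * M.parityInv)) * (M.parityInv * (b * M.parityInv)) =
          M.parityInv * (a * b * M.parityInv) := by
      intro a b
      calc _ = M.parityInv * a * (M.parityInv * M.parityInv) * b * M.parityInv := by
            simp only [mul_assoc]
        _ = _ := by rw [M.parityInv_sq]; simp only [mul_assoc, one_mul]
    simp only [LinearMap.comp_apply, LinearMap.mulLeft_apply, LinearMap.mulRight_apply]
    rw [key, key, M.ρ_br i j x hx y hy, sub_mul, mul_sub, smul_mul_assoc, mul_smul_comm]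

/-- A submodule of a `𝔤`-module in the super sense: a `𝔤`-invariant subspace which contains the
homogeneous components of each of its elements. -/
@[ext] structure Sub (M : SuperModule 𝔤) where
  carrier : Submodule ℂ M.carrier
  graded : ∀ a ∈ M.gr 0, ∀ b ∈ M.gr 1, a + b ∈ carrier → a ∈ carrier ∧ b ∈ carrier
  invariant : ∀ (x : 𝔤.carrier), ∀ v ∈ carrier, M.ρ x v ∈ carrier

namespace Sub

variable {M : SuperModule 𝔤}

instance : PartialOrder (Sub M) :=
  PartialOrder.lift Sub.carrier fun _ _ h => Sub.ext h

theorem le_def {K N : Sub M} : K ≤ N ↔ K.carrier ≤ N.carrier := Iff.rfl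

instance : SupSet (Sub M) where
  sSup S :=
    { carrier := sSup (Sub.carrier '' S)
      graded := by
        intro a ha b hb hab
        have key : sSup (Sub.carrier '' S) ≤
            (sSup (Sub.carrier '' S) ⊓ M.gr 0) ⊔ (sSup (Sub.carrier '' S) ⊓ M.gr 1) := by
          refine sSup_le ?_
          rintro _ ⟨N, hN, rfl⟩ v hv
          have hle : N.carrier ≤ sSup (Sub.carrier '' S) := le_sSup ⟨N, hN, rfl⟩
          obtain ⟨c, hc, d, hd, rfl⟩ := M.exists_add v
          obtain ⟨h1, h2⟩ := N.graded c hc d hd hv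
          exact Submodule.add_mem_sup ⟨hle h1, hc⟩ ⟨hle h2, hd⟩
        obtain ⟨c, hc, d, hd, h⟩ := Submodule.mem_sup.1 (key hab)
        have hz : a - c ∈ M.gr 0 ⊓ M.gr 1 := by
          refine ⟨sub_mem ha hc.2, ?_⟩
          have : a - c = d - b := by
            rw [sub_eq_sub_iff_add_eq_add, ← h, add_comm]
          rw [this]; exact sub_mem hd.2 hb
        rw [M.isCompl.inf_eq_bot, Submodule.mem_bot, sub_eq_zero] at hz
        subst hz
        have : d = b := add_left_cancel h
        subst this
        exact ⟨hc.1, hd.1⟩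
      invariant := by
        intro x
        change sSup (Sub.carrier '' S) ≤ (sSup (Sub.carrier '' S)).comap (M.ρ x)
        refine sSup_le ?_
        rintro _ ⟨N, hN, rfl⟩ v hv
        have hle : N.carrier ≤ sSup (Sub.carrier '' S) := le_sSup ⟨N, hN, rfl⟩
        exact hle (N.invariant x v hv) }

instance : InfSet (Sub M) where
  sInf S :=
    { carrier := sInf (Sub.carrier '' S)
      graded := by
        intro a ha b hb hab
        simp only [Submodule.mem_sInf, Set.forall_mem_image] at hab ⊢
        exact ⟨fun N hN => (N.graded a ha b hb (hab hN)).1,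
          fun N hN => (N.graded a ha b hb (hab hN)).2⟩
      invariant := by
        intro x v hv
        simp only [Submodule.mem_sInf, Set.forall_mem_image] at hv ⊢
        exact fun N hN => N.invariant x v (hv hN) }

theorem isLUB_sSup (S : Set (Sub M)) : IsLUB S (sSup S) :=
  ⟨fun N hN => le_sSup (α := Submodule ℂ M.carrier) ⟨N, hN, rfl⟩,
    fun K hK => sSup_le (α := Submodule ℂ M.carrier) (by rintro _ ⟨N, hN, rfl⟩; exact hK hN)⟩

theorem isGLB_sInf (S : Set (Sub M)) : IsGLB S (sInf S) :=
  ⟨fun N hN => sInf_le (α := Submodule ℂ M.carrier) ⟨N, hN, rfl⟩,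
    fun K hK => le_sInf (α := Submodule ℂ M.carrier) (by rintro _ ⟨N, hN, rfl⟩; exact hK hN)⟩

/-- The lattice of submodules of a `𝔤`-module, ordered by inclusion. -/
instance : CompleteLattice (Sub M) :=
  { completeLatticeOfInf (Sub M) isGLB_sInf with
    sSup := sSup
    isLUB_sSup := isLUB_sSup
    bot :=
      { carrier := ⊥
        graded := by
          intro a ha b hb hab
          rw [Submodule.mem_bot] at hab
          have h : a ∈ M.gr 0 ⊓ M.gr 1 :=
            ⟨ha, by rw [eq_neg_of_add_eq_zero_left hab]; exact neg_mem hb⟩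
          rw [M.isCompl.inf_eq_bot, Submodule.mem_bot] at h
          subst h
          simpa using hab
        invariant := by intro x v hv; rw [Submodule.mem_bot] at hv; simp [hv] }
    bot_le := fun N => (bot_le : (⊥ : Submodule ℂ M.carrier) ≤ N.carrier)
    top :=
      { carrier := ⊤
        graded := fun _ _ _ _ _ => ⟨trivial, trivial⟩
        invariant := fun _ _ _ => trivial }
    le_top := fun N => (le_top : N.carrier ≤ (⊤ : Submodule ℂ M.carrier)) }

/-- The subquotient `N / (K ∩ N)` of `M`; for `K ≤ N` this is the module `N / K`. -/
def subquotient (K N : Sub M) : SuperModule 𝔤 where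
  carrier := N.carrier ⧸ K.carrier.comap N.carrier.subtype
  gr i := ((M.gr i).comap N.carrier.subtype).map (K.carrier.comap N.carrier.subtype).mkQ
  isCompl := by
    constructor
    · rw [Submodule.disjoint_def]
      rintro _ ⟨⟨a, haN⟩, ha, rfl⟩ ⟨⟨b, hbN⟩, hb, hab⟩
      have hK : b - a ∈ K.carrier := by
        have := (Submodule.Quotient.eq _).1 hab
        simpa using this
      have hK' : (-a) + b ∈ K.carrier := by rwa [neg_add_eq_sub]
      have h := (K.graded (-a) (neg_mem ha) b hb hK').1
      rw [Submodule.mkQ_apply, Submodule.Quotient.mk_eq_zero]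
      simpa using neg_mem h
    · rw [codisjoint_iff, eq_top_iff]
      intro v _
      obtain ⟨⟨v, hv⟩, rfl⟩ := Submodule.mkQ_surjective _ v
      obtain ⟨a, ha, b, hb, rfl⟩ := M.exists_add v
      obtain ⟨h1, h2⟩ := N.graded a ha b hb hv
      have : (⟨a + b, hv⟩ : N.carrier) = ⟨a, h1⟩ + ⟨b, h2⟩ := rfl
      rw [this, map_add]
      exact Submodule.add_mem_sup ⟨_, ha, rfl⟩ ⟨_, hb, rfl⟩
  ρ :=
    { toFun := fun x => Submodule.mapQ _ _ ((M.ρ x).restrict (N.invariant x))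
        (fun v hv => K.invariant x v.1 hv)
      map_add' := by
        intro x y
        refine Submodule.linearMap_qext _ (LinearMap.ext fun v => ?_)
        have h : (M.ρ (x + y)).restrict (N.invariant (x + y)) v =
            (M.ρ x).restrict (N.invariant x) v + (M.ρ y).restrict (N.invariant y) v :=
          Subtype.ext (by simp)
        exact congrArg (K.carrier.comap N.carrier.subtype).mkQ h
      map_smul' := by
        intro c x
        refine Submodule.linearMap_qext _ (LinearMap.ext fun v => ?_)
        have h : (M.ρ (c • x)).restrict (N.invariant (c • x)) v =
            c • (M.ρ x).restrict (N.invariant x) v := Subtype.ext (by simp)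
        exact congrArg (K.carrier.comap N.carrier.subtype).mkQ h }
  ρ_mem := by
    rintro i j x hx _ ⟨v, hv, rfl⟩
    exact ⟨_, M.ρ_mem i j x hx _ hv, rfl⟩
  ρ_br := by
    intro i j x hx y hy
    refine Submodule.linearMap_qext _ (LinearMap.ext fun v => ?_)
    have h : (M.ρ (𝔤.br x y)).restrict (N.invariant _) v =
        (M.ρ x).restrict (N.invariant x) ((M.ρ y).restrict (N.invariant y) v) -
          koszul i j • (M.ρ y).restrict (N.invariant y) ((M.ρ x).restrict (N.invariant x) v) :=
      Subtype.ext (by simp [M.ρ_br i j x hx y hy])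
    exact congrArg (K.carrier.comap N.carrier.subtype).mkQ h

end Sub

/-- `M` is simple: it is nonzero and has no submodules except `0` and `M`. -/
def IsSimple (M : SuperModule 𝔤) : Prop := IsSimpleOrder (Sub M)

/-- The radical: the intersection of all maximal submodules. -/
def radical (M : SuperModule 𝔤) : Sub M := sInf {N | IsCoatom N}

/-- The head `M / rad M`. -/
def head (M : SuperModule 𝔤) : SuperModule 𝔤 := Sub.subquotient M.radical ⊤

/-- The socle filtration `0 = soc₀ ≤ soc₁ ≤ ⋯`, where `soc_{k+1} / soc_k` is the socle (the sum of
all simple submodules) of `M / soc_k`. The simple submodules of `M / soc_k` are the `N / soc_k`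
with `N` covering `soc_k`. In particular `soc₁` is the socle of `M`. -/
def socleSeries (M : SuperModule 𝔤) : ℕ → Sub M
  | 0 => ⊥
  | k + 1 => M.socleSeries k ⊔ sSup {N | M.socleSeries k ⋖ N}

/-- The layer `soc_{k+1} / soc_k` of the socle filtration; layer `0` is the socle. -/
def socleLayer (M : SuperModule 𝔤) (k : ℕ) : SuperModule 𝔤 :=
  Sub.subquotient (M.socleSeries k) (M.socleSeries (k + 1))

/-- The trivial module `ℂ = ℂ^{1|0}`. -/
def trivialModule (𝔤 : LieSuperalgebra) : SuperModule 𝔤 where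
  carrier := ℂ
  gr i := if i = 0 then ⊤ else ⊥
  isCompl := by simpa using isCompl_top_bot
  ρ := 0
  ρ_mem := by intros; simp
  ρ_br := by intros; simp

end SuperModule

/-! ### The periplectic Lie superalgebra `𝔭(n)` -/

theorem koszul_add_right (i j k : ZMod 2) : koszul i (j + k) = koszul i j * koszul i k := by
  have h : ∀ p : ZMod 2, p = 0 ∨ p = 1 := by decide
  have h2 : (1 + 1 : ZMod 2) = 0 := by decide
  rcases h i with rfl | rfl <;> rcases h j with rfl | rfl <;> rcases h k with rfl | rfl <;>
    simp [koszul, h2]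

theorem koszul_comm (i j : ZMod 2) : koszul i j = koszul j i := by
  unfold koszul; simp only [and_comm]

theorem koszul_add_left (i j k : ZMod 2) : koszul (i + j) k = koszul i k * koszul j k := by
  rw [koszul_comm, koszul_add_right, koszul_comm k i, koszul_comm k j]

theorem koszul_sq (i j : ZMod 2) : koszul i j * koszul i j = 1 := by
  unfold koszul; split_ifs <;> norm_num

/-- The parity of a basis vector of `ℂ^{n|n}`, whose basis is indexed by `Fin n ⊕ Fin n`. -/
def par {n : ℕ} : Fin n ⊕ Fin n → ZMod 2
  | .inl _ => 0
  | .inr _ => 1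

/-- `(n|n) × (n|n)` supermatrices. -/
abbrev Mat (n : ℕ) := Matrix (Fin n ⊕ Fin n) (Fin n ⊕ Fin n) ℂ

/-- Supermatrices of parity `i`: block diagonal for `i = 0`, block antidiagonal for `i = 1`. -/
def matGr (n : ℕ) (i : ZMod 2) : Submodule ℂ (Mat n) where
  carrier := {X | ∀ a b, par a + par b ≠ i → X a b = 0}
  add_mem' := by intro X Y hX hY a b h; simp [hX a b h, hY a b h]
  zero_mem' := by intro a b _; rfl
  smul_mem' := by intro c X hX a b h; simp [hX a b h]

/-- The supercommutator of supermatrices: the bilinear extension of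
`[X, Y] = X Y - (-1)^{|X||Y|} Y X` from homogeneous to arbitrary `X`, `Y`. -/
def superComm (n : ℕ) : Mat n →ₗ[ℂ] Mat n →ₗ[ℂ] Mat n :=
  LinearMap.mk₂ ℂ
    (fun X Y => X * Y - Matrix.of fun a c =>
      ∑ b, koszul (par b + par c) (par a + par b) * (Y a b * X b c))
    (by intro X X' Y; ext a c
        simp only [add_mul, Matrix.add_apply, Matrix.sub_apply, Matrix.of_apply, mul_add,
          Finset.sum_add_distrib]
        ring)
    (by intro r X Y; ext a c
        simp only [Matrix.smul_mul, Matrix.smul_apply, Matrix.sub_apply, Matrix.of_apply,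
          smul_eq_mul, mul_sub, Finset.mul_sum]
        congr 1; exact Finset.sum_congr rfl fun _ _ => by ring)
    (by intro X Y Y'; ext a c
        simp only [mul_add, add_mul, Matrix.add_apply, Matrix.sub_apply, Matrix.of_apply,
          Finset.sum_add_distrib]
        ring)
    (by intro r X Y; ext a c
        simp only [Matrix.mul_smul, Matrix.smul_apply, Matrix.sub_apply, Matrix.of_apply,
          smul_eq_mul, mul_sub, Finset.mul_sum]
        congr 1; exact Finset.sum_congr rfl fun _ _ => by ring)

theorem superComm_apply {n : ℕ} {i j : ZMod 2} {X Y : Mat n} (hX : X ∈ matGr n i)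
    (hY : Y ∈ matGr n j) : superComm n X Y = X * Y - koszul i j • (Y * X) := by
  ext a c
  simp only [superComm, LinearMap.mk₂_apply, Matrix.sub_apply, Matrix.of_apply, Matrix.smul_apply,
    Matrix.mul_apply, smul_eq_mul, Finset.mul_sum]
  congr 1
  refine Finset.sum_congr rfl fun b _ => ?_
  by_cases h1 : par a + par b = j
  · by_cases h2 : par b + par c = i
    · rw [h1, h2]
    · simp [hX b c h2]
  · simp [hY a b h1]

theorem mul_mem_matGr {n : ℕ} {i j : ZMod 2} {X Y : Mat n} (hX : X ∈ matGr n i)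
    (hY : Y ∈ matGr n j) : X * Y ∈ matGr n (i + j) := by
  intro a c h
  rw [Matrix.mul_apply]
  refine Finset.sum_eq_zero fun b _ => ?_
  by_cases h1 : par a + par b = i
  · have h2 : par b + par c ≠ j := by
      rintro rfl
      refine h ?_
      rw [← h1]
      generalize par a = p; generalize par b = q; generalize par c = r
      revert p q r; decide
    rw [hY b c h2, mul_zero]
  · rw [hX a b h1, zero_mul]

theorem superComm_mem {n : ℕ} {i j : ZMod 2} {X Y : Mat n} (hX : X ∈ matGr n i)
    (hY : Y ∈ matGr n j) : superComm n X Y ∈ matGr n (i + j) := by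
  rw [superComm_apply hX hY]
  refine sub_mem (mul_mem_matGr hX hY) (Submodule.smul_mem _ _ ?_)
  rw [add_comm]
  exact mul_mem_matGr hY hX

theorem matGr_add (n : ℕ) (X : Mat n) : ∃ Y ∈ matGr n 0, ∃ Z ∈ matGr n 1, X = Y + Z := by
  refine ⟨Matrix.of fun a b => if par a + par b = 0 then X a b else 0, ?_,
    Matrix.of fun a b => if par a + par b = 0 then 0 else X a b, ?_, ?_⟩
  · intro a b h; simp [h]
  · intro a b h
    have : par a + par b = 0 := by
      revert h; generalize par a + par b = p; revert p; decide
    simp [this]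
  · ext a b
    by_cases h : par a + par b = 0 <;> simp [h]

theorem superComm_skew {n : ℕ} {i j : ZMod 2} {X Y : Mat n} (hX : X ∈ matGr n i)
    (hY : Y ∈ matGr n j) : superComm n X Y = -(koszul i j • superComm n Y X) := by
  rw [superComm_apply hX hY, superComm_apply hY hX, smul_sub, smul_smul, koszul_comm j i,
    koszul_sq, one_smul]
  abel

theorem superComm_jacobi {n : ℕ} {i j : ZMod 2} {X Y : Mat n} (hX : X ∈ matGr n i)
    (hY : Y ∈ matGr n j) (Z : Mat n) :
    superComm n X (superComm n Y Z) =
      superComm n (superComm n X Y) Z + koszul i j • superComm n Y (superComm n X Z) := by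
  have key : ∀ k : ZMod 2, ∀ Z ∈ matGr n k, superComm n X (superComm n Y Z) =
      superComm n (superComm n X Y) Z + koszul i j • superComm n Y (superComm n X Z) := by
    intro k Z hZ
    rw [superComm_apply hX (superComm_mem hY hZ), superComm_apply (superComm_mem hX hY) hZ,
      superComm_apply hY (superComm_mem hX hZ), superComm_apply hX hY, superComm_apply hY hZ,
      superComm_apply hX hZ, koszul_add_right, koszul_add_left, koszul_add_right, koszul_comm j i]
    have hs := koszul_sq i j
    simp only [sub_mul, mul_sub, smul_sub, smul_smul, mul_assoc, smul_mul_assoc, mul_smul_comm]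
    have e1 : koszul i j * (koszul i j * koszul j k) = koszul j k := by rw [← mul_assoc, hs, one_mul]
    have e2 : koszul i j * (koszul i j * (koszul j k * koszul i k)) = koszul i k * koszul j k := by
      rw [← mul_assoc, hs, one_mul, mul_comm]
    rw [e1, e2]
    have e3 : koszul i j * (koszul i k * koszul j k) = koszul i k * (koszul j k * koszul i j) := by
      ring
    simp only [mul_comm, mul_left_comm] at *
    abel
  obtain ⟨A, hA, B, hB, rfl⟩ := matGr_add n Z
  simp only [map_add, smul_add, key 0 A hA, key 1 B hB]
  abel

/-- The matrices `[[A, B], [C, -Aᵗ]]` with `Bᵗ = B` and `Cᵗ = -C`. -/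
def periplecticSubmodule (n : ℕ) : Submodule ℂ (Mat n) where
  carrier := {X | (∀ i j, X (.inr i) (.inr j) = -X (.inl j) (.inl i)) ∧
    (∀ i j, X (.inl i) (.inr j) = X (.inl j) (.inr i)) ∧
    (∀ i j, X (.inr i) (.inl j) = -X (.inr j) (.inl i))}
  add_mem' := by
    rintro X Y ⟨h1, h2, h3⟩ ⟨h1', h2', h3'⟩
    refine ⟨fun i j => ?_, fun i j => ?_, fun i j => ?_⟩
    · rw [Matrix.add_apply, Matrix.add_apply, h1, h1']; ring
    · rw [Matrix.add_apply, Matrix.add_apply, h2, h2']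
    · rw [Matrix.add_apply, Matrix.add_apply, h3, h3']; ring
  zero_mem' := by simp
  smul_mem' := by
    rintro c X ⟨h1, h2, h3⟩
    refine ⟨fun i j => ?_, fun i j => ?_, fun i j => ?_⟩
    · rw [Matrix.smul_apply, Matrix.smul_apply, h1, smul_neg]
    · rw [Matrix.smul_apply, Matrix.smul_apply, h2]
    · rw [Matrix.smul_apply, Matrix.smul_apply, h3, smul_neg]

theorem superComm_mem_periplectic {n : ℕ} {X Y : Mat n} (hX : X ∈ periplecticSubmodule n)
    (hY : Y ∈ periplecticSubmodule n) : superComm n X Y ∈ periplecticSubmodule n := by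
  obtain ⟨h1, h2, h3⟩ := hX
  obtain ⟨k1, k2, k3⟩ := hY
  have hd : (1 + 1 : ZMod 2) = 0 := by decide
  refine ⟨fun i j => ?_, fun i j => ?_, fun i j => ?_⟩ <;>
  · simp only [superComm, LinearMap.mk₂_apply, Matrix.sub_apply, Matrix.of_apply, Matrix.mul_apply,
      Fintype.sum_sum_type, par, koszul, hd]
    simp only [← Finset.sum_add_distrib, ← Finset.sum_sub_distrib, ← Finset.sum_neg_distrib]
    refine Finset.sum_congr rfl fun b _ => ?_
    norm_num
    simp only [h1, k1]
    try rw [h2 i b, k2 i b]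
    try rw [h3 i b, k3 i b]
    try rw [h2 j b, k2 j b]
    try rw [h3 j b, k3 j b]
    ring

/-- The periplectic Lie superalgebra `𝔭(n)`. -/
def periplectic (n : ℕ) : LieSuperalgebra where
  carrier := periplecticSubmodule n
  gr i := (matGr n i).comap (periplecticSubmodule n).subtype
  isCompl := by
    constructor
    · rw [Submodule.disjoint_def]
      intro X h0 h1
      ext a b
      by_cases h : par a + par b = 0
      · exact h1 a b (by rw [h]; decide)
      · exact h0 a b h
    · rw [codisjoint_iff, eq_top_iff]
      rintro ⟨X, h1, h2, h3⟩ -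
      have hd : (1 + 1 : ZMod 2) = 0 := by decide
      refine Submodule.mem_sup.2 ⟨⟨Matrix.of fun a b => if par a + par b = 0 then X a b else 0,
        ?_⟩, ?_, ⟨Matrix.of fun a b => if par a + par b = 0 then 0 else X a b, ?_⟩, ?_, ?_⟩
      · refine ⟨fun i j => ?_, fun i j => ?_, fun i j => ?_⟩ <;> simp [par, hd, h1 i j]
      · intro a b h; simp [h]
      · refine ⟨fun i j => ?_, fun i j => ?_, fun i j => ?_⟩ <;> simp [par, hd, h2 i j, h3 i j]
      · intro a b h
        have : par a + par b = 0 := by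
          revert h; generalize par a + par b = p; revert p; decide
        simp [this]
      · ext a b
        by_cases h : par a + par b = 0 <;> simp [h]
  br := LinearMap.mk₂ ℂ
    (fun X Y => (⟨superComm n X.1 Y.1, superComm_mem_periplectic X.2 Y.2⟩ :
      periplecticSubmodule n))
    (by intros; ext1; simp) (by intros; ext1; simp) (by intros; ext1; simp) (by intros; ext1; simp)
  br_mem := fun _ _ _ hx _ hy => superComm_mem hx hy
  br_skew := fun _ _ _ hx _ hy => Subtype.ext (superComm_skew hx hy)
  jacobi := fun _ _ _ hx _ hy z => Subtype.ext (superComm_jacobi hx hy z.1)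

theorem mulVec_mem {n : ℕ} {i j : ZMod 2} {X : Mat n} (hX : X ∈ matGr n i)
    {v : Fin n ⊕ Fin n → ℂ} (hv : ∀ a, par a ≠ j → v a = 0) :
    ∀ a, par a ≠ i + j → Matrix.toLin' X v a = 0 := by
  intro a h
  rw [Matrix.toLin'_apply, Matrix.mulVec, dotProduct]
  refine Finset.sum_eq_zero fun b _ => ?_
  by_cases h1 : par a + par b = i
  · have h2 : par b ≠ j := by
      rintro rfl
      refine h ?_
      rw [← h1]
      generalize par a = p; generalize par b = q
      revert p q; decide
    rw [hv b h2, mul_zero]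
  · rw [hX a b h1, zero_mul]

theorem toLin'_superComm {n : ℕ} {i j : ZMod 2} {X Y : Mat n} (hX : X ∈ matGr n i)
    (hY : Y ∈ matGr n j) : Matrix.toLin' (superComm n X Y) =
      Matrix.toLin' X * Matrix.toLin' Y - koszul i j • (Matrix.toLin' Y * Matrix.toLin' X) := by
  rw [superComm_apply hX hY, map_sub, map_smul, Matrix.toLin'_mul, Matrix.toLin'_mul]
  rfl

/-- The standard module `P_{n|n} = ℂ^{n|n}` of `𝔭(n)`. -/
def standardModule (n : ℕ) : SuperModule (periplectic n) where
  carrier := Fin n ⊕ Fin n → ℂ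
  gr i :=
    { carrier := {v | ∀ a, par a ≠ i → v a = 0}
      add_mem' := by intro v w hv hw a h; simp [hv a h, hw a h]
      zero_mem' := by intro a _; rfl
      smul_mem' := by intro c v hv a h; simp [hv a h] }
  isCompl := by
    constructor
    · rw [Submodule.disjoint_def]
      intro v h0 h1
      ext a
      by_cases h : par a = 0
      · exact h1 a (by rw [h]; decide)
      · exact h0 a h
    · rw [codisjoint_iff, eq_top_iff]
      intro v _
      refine Submodule.mem_sup.2 ⟨fun a => if par a = 0 then v a else 0, ?_,
        fun a => if par a = 0 then 0 else v a, ?_, ?_⟩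
      · intro a h; simp [h]
      · intro a h
        have : par a = 0 := by
          revert h; generalize par a = p; revert p; decide
        simp [this]
      · ext a
        by_cases h : par a = 0 <;> simp [h]
  ρ := (Matrix.toLin' : Mat n ≃ₗ[ℂ] _).toLinearMap ∘ₗ (periplecticSubmodule n).subtype
  ρ_mem := by
    intro i j X hX v hv
    exact mulVec_mem hX hv
  ρ_br := by
    intro i j X hX Y hY
    exact toLin'_superComm hX hY

/-! ### The symmetric powers of the standard module -/

/-- The (super)symmetric algebra of `V = ℂ^{n|n}`,
`S(V) = S(V₀) ⊗ Λ(V₁) = ℂ[x₁, …, xₙ] ⊗ Λ[ξ₁, …, ξₙ]`.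
As `ℂ[x₁, …, xₙ]` is purely even, the product is that of the ordinary tensor product. -/
def SymAlg (n : ℕ) : Type := MvPolynomial (Fin n) ℂ ⊗[ℂ] ExteriorAlgebra ℂ (Fin n → ℂ)

instance (n : ℕ) : Ring (SymAlg n) :=
  inferInstanceAs (Ring (MvPolynomial (Fin n) ℂ ⊗[ℂ] ExteriorAlgebra ℂ (Fin n → ℂ)))

instance (n : ℕ) : Algebra ℂ (SymAlg n) :=
  inferInstanceAs (Algebra ℂ (MvPolynomial (Fin n) ℂ ⊗[ℂ] ExteriorAlgebra ℂ (Fin n → ℂ)))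

/-- The element `p ⊗ w` of `S(V) = ℂ[x] ⊗ Λ[ξ]`, as a bilinear map. -/
def tm (n : ℕ) : MvPolynomial (Fin n) ℂ →ₗ[ℂ] ExteriorAlgebra ℂ (Fin n → ℂ) →ₗ[ℂ] SymAlg n :=
  TensorProduct.mk ℂ _ _

/-- The endomorphism `f ⊗ g` of `S(V) = ℂ[x] ⊗ Λ[ξ]`. -/
def mapEnd (n : ℕ) (f : Module.End ℂ (MvPolynomial (Fin n) ℂ))
    (g : Module.End ℂ (ExteriorAlgebra ℂ (Fin n → ℂ))) : Module.End ℂ (SymAlg n) :=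
  TensorProduct.map f g

/-- The generators `x₁, …, xₙ` (even) and `ξ₁, …, ξₙ` (odd), i.e. the basis of `V`. -/
def gen (n : ℕ) : Fin n ⊕ Fin n → SymAlg n
  | .inl i => tm n (MvPolynomial.X i) 1
  | .inr i => tm n 1 (ExteriorAlgebra.ι ℂ (Pi.single i 1))

/-- The derivations `∂/∂x_i` (even) and `∂/∂ξ_i` (odd, acting from the left). -/
def der (n : ℕ) : Fin n ⊕ Fin n → Module.End ℂ (SymAlg n)
  | .inl i => mapEnd n (MvPolynomial.pderiv i).toLinearMap 1
  | .inr i => mapEnd n 1 (CliffordAlgebra.contractLeft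
      (Q := (0 : QuadraticForm ℂ (Fin n → ℂ))) (LinearMap.proj i))

/-- The parity involution of `S(V)`, the algebra automorphism `x_i ↦ x_i`, `ξ_i ↦ -ξ_i`. -/
def invol (n : ℕ) : Module.End ℂ (SymAlg n) :=
  mapEnd n 1 (CliffordAlgebra.involute (Q := (0 : QuadraticForm ℂ (Fin n → ℂ)))).toLinearMap

/-- `S^d V`: the span in `S(V)` of all `d`-fold products of elements of `V`. -/
def symDeg (n d : ℕ) : Submodule ℂ (SymAlg n) := (Submodule.span ℂ (Set.range (gen n))) ^ d

/-- The action of a supermatrix on `S(V)` which extends its action on `V`: the matrix unit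
`E_{ab}` acts as the first order differential operator `y_a ∂/∂y_b`, where `y = (x, ξ)`. -/
def matAct (n : ℕ) : Mat n →ₗ[ℂ] Module.End ℂ (SymAlg n) where
  toFun X := ∑ a, ∑ b, X a b • (LinearMap.mulLeft ℂ (gen n a) * der n b)
  map_add' X Y := by simp [add_smul, Finset.sum_add_distrib]
  map_smul' c X := by simp [Finset.smul_sum, smul_smul]

/-- The odd contraction `∑ i, ∂²/∂x_i∂ξ_i` on `S(V)`, which is the contraction with the odd form
on `V` that pairs `x_i` with `ξ_i`. -/
def contr (n : ℕ) : Module.End ℂ (SymAlg n) := ∑ i, der n (.inl i) * der n (.inr i)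

section Relations

variable {n : ℕ}

theorem symAlg_ext {f g : Module.End ℂ (SymAlg n)}
    (h : ∀ p w, f (tm n p w) = g (tm n p w)) : f = g :=
  TensorProduct.ext' h

theorem tm_mul (p p' : MvPolynomial (Fin n) ℂ) (w w' : ExteriorAlgebra ℂ (Fin n → ℂ)) :
    tm n p w * tm n p' w' = tm n (p * p') (w * w') :=
  Algebra.TensorProduct.tmul_mul_tmul p p' w w'

theorem tm_one : tm n 1 1 = 1 := rfl

theorem mapEnd_tm (f : Module.End ℂ (MvPolynomial (Fin n) ℂ))
    (g : Module.End ℂ (ExteriorAlgebra ℂ (Fin n → ℂ))) (p : MvPolynomial (Fin n) ℂ)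
    (w : ExteriorAlgebra ℂ (Fin n → ℂ)) : mapEnd n f g (tm n p w) = tm n (f p) (g w) := rfl

theorem ι_comm (u v : Fin n → ℂ) (w : ExteriorAlgebra ℂ (Fin n → ℂ)) :
    ExteriorAlgebra.ι ℂ u * (ExteriorAlgebra.ι ℂ v * w) =
      -(ExteriorAlgebra.ι ℂ v * (ExteriorAlgebra.ι ℂ u * w)) := by
  have h := ExteriorAlgebra.ι_add_mul_swap (R := ℂ) (M := Fin n → ℂ) u v
  rw [← mul_assoc, ← mul_assoc, eq_neg_of_add_eq_zero_left h, neg_mul]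

theorem gen_gen (a b : Fin n ⊕ Fin n) :
    LinearMap.mulLeft ℂ (gen n a) * LinearMap.mulLeft ℂ (gen n b) =
      koszul (par a) (par b) • (LinearMap.mulLeft ℂ (gen n b) * LinearMap.mulLeft ℂ (gen n a)) := by
  refine symAlg_ext fun p w => ?_
  rcases a with i | i <;> rcases b with j | j <;>
    simp [gen, par, koszul, tm_mul]
  · rw [mul_left_comm]
  · rw [ι_comm, map_neg]

theorem pderiv_comm' (i j : Fin n) (p : MvPolynomial (Fin n) ℂ) :
    MvPolynomial.pderiv i (MvPolynomial.pderiv j p) =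
      MvPolynomial.pderiv j (MvPolynomial.pderiv i p) := by
  have h : ⁅MvPolynomial.pderiv (R := ℂ) i, MvPolynomial.pderiv (R := ℂ) j⁆ = 0 := by
    refine MvPolynomial.derivation_ext fun k => ?_
    rw [Derivation.commutator_apply]
    simp [MvPolynomial.pderiv_X, Pi.single_apply, apply_ite]
  have := congrArg (fun D => D p) h
  rw [Derivation.commutator_apply] at this
  exact sub_eq_zero.1 this

theorem der_der (a b : Fin n ⊕ Fin n) :
    der n a * der n b = koszul (par a) (par b) • (der n b * der n a) := by
  refine symAlg_ext fun p w => ?_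
  rcases a with i | i <;> rcases b with j | j <;>
    simp [der, par, koszul, mapEnd_tm]
  · rw [pderiv_comm']
  · rw [CliffordAlgebra.contractLeft_comm, map_neg]

theorem contract_ι (i j : Fin n) (w : ExteriorAlgebra ℂ (Fin n → ℂ)) :
    CliffordAlgebra.contractLeft (Q := (0 : QuadraticForm ℂ (Fin n → ℂ))) (LinearMap.proj j)
      (ExteriorAlgebra.ι ℂ (Pi.single i 1) * w) = (if j = i then (1 : ℂ) else 0) • w -
      ExteriorAlgebra.ι ℂ (Pi.single i 1) * CliffordAlgebra.contractLeft
        (Q := (0 : QuadraticForm ℂ (Fin n → ℂ))) (LinearMap.proj j) w := by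
  have h := CliffordAlgebra.contractLeft_ι_mul (Q := (0 : QuadraticForm ℂ (Fin n → ℂ)))
    (d := LinearMap.proj j) (Pi.single i 1) w
  rw [LinearMap.proj_apply, Pi.single_apply] at h
  exact h

theorem der_gen (a b : Fin n ⊕ Fin n) :
    der n b * LinearMap.mulLeft ℂ (gen n a) = (if b = a then (1 : ℂ) else 0) • 1 +
      koszul (par a) (par b) • (LinearMap.mulLeft ℂ (gen n a) * der n b) := by
  refine symAlg_ext fun p w => ?_
  rcases a with i | i <;> rcases b with j | j <;>
    simp [der, gen, par, koszul, tm_mul, mapEnd_tm, MvPolynomial.pderiv_X,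
      Pi.single_apply]
  · by_cases h : j = i
    · subst h; simp [add_comm]
    · simp [h, Ne.symm h]
  · rw [contract_ι]
    by_cases h : j = i
    · subst h; simp [sub_eq_add_neg, map_add, map_neg]
    · simp [h, map_neg]

theorem invol_gen (a : Fin n ⊕ Fin n) :
    invol n * LinearMap.mulLeft ℂ (gen n a) =
      koszul (par a) 1 • (LinearMap.mulLeft ℂ (gen n a) * invol n) := by
  refine symAlg_ext fun p w => ?_
  rcases a with i | i
  · simp [invol, gen, par, koszul, tm_mul, mapEnd_tm]
  · simp [invol, gen, par, koszul, tm_mul, mapEnd_tm]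

theorem invol_invol : invol n * invol n = 1 := by
  refine symAlg_ext fun p w => ?_
  simp [invol, mapEnd_tm]

theorem invol_one : invol n 1 = 1 := by
  simp [invol, ← tm_one, mapEnd_tm]

theorem der_one (b : Fin n ⊕ Fin n) : der n b 1 = 0 := by
  rcases b with j | j <;> simp [der, ← tm_one, mapEnd_tm]

end Relations

section Stability

variable {n : ℕ}

theorem symDeg_zero : symDeg n 0 = Submodule.span ℂ {1} := by
  rw [symDeg, pow_zero, Submodule.one_eq_span]

/-- Induction on generators: to prove a property of all elements of `S^{d+1} V` closed under sums,
it is enough to treat the products `y_a f` with `f ∈ S^d V`. -/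
theorem symDeg_succ_le {d : ℕ} {N : Submodule ℂ (SymAlg n)}
    (h : ∀ a, ∀ f ∈ symDeg n d, gen n a * f ∈ N) : symDeg n (d + 1) ≤ N := by
  rw [symDeg, pow_succ', Submodule.mul_le]
  intro v hv f hf
  induction hv using Submodule.span_induction with
  | mem v hv => obtain ⟨a, rfl⟩ := hv; exact h a f hf
  | zero => rw [zero_mul]; exact zero_mem _
  | add u v _ _ hu hv => rw [add_mul]; exact add_mem hu hv
  | smul c v _ hv => rw [smul_mul_assoc]; exact Submodule.smul_mem _ _ hv

theorem gen_mul_mem {d : ℕ} (a : Fin n ⊕ Fin n) {f : SymAlg n} (hf : f ∈ symDeg n d) :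
    gen n a * f ∈ symDeg n (d + 1) := by
  rw [symDeg, pow_succ']
  exact Submodule.mul_mem_mul (Submodule.subset_span ⟨a, rfl⟩) hf

theorem der_mem_zero (b : Fin n ⊕ Fin n) {f : SymAlg n} (hf : f ∈ symDeg n 0) :
    der n b f = 0 := by
  rw [symDeg_zero, Submodule.mem_span_singleton] at hf
  obtain ⟨c, rfl⟩ := hf
  rw [map_smul, der_one, smul_zero]

theorem der_gen_mul (a b : Fin n ⊕ Fin n) (f : SymAlg n) :
    der n b (gen n a * f) = (if b = a then (1 : ℂ) else 0) • f +
      koszul (par a) (par b) • (gen n a * der n b f) := by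
  have := LinearMap.congr_fun (der_gen a b) f
  simpa only [Module.End.mul_apply, LinearMap.mulLeft_apply, LinearMap.add_apply,
    LinearMap.smul_apply, Module.End.one_apply] using this

theorem der_mem_succ (b : Fin n ⊕ Fin n) (d : ℕ) {f : SymAlg n} (hf : f ∈ symDeg n (d + 1)) :
    der n b f ∈ symDeg n d := by
  induction d generalizing f with
  | zero =>
    refine symDeg_succ_le (N := (symDeg n 0).comap (der n b)) (fun a g hg => ?_) hf
    rw [Submodule.mem_comap, der_gen_mul, der_mem_zero b hg, mul_zero, smul_zero, add_zero]
    exact Submodule.smul_mem _ _ hg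
  | succ d ih =>
    refine symDeg_succ_le (N := (symDeg n (d + 1)).comap (der n b)) (fun a g hg => ?_) hf
    rw [Submodule.mem_comap, der_gen_mul]
    exact add_mem (Submodule.smul_mem _ _ hg) (Submodule.smul_mem _ _ (gen_mul_mem a (ih hg)))

theorem der_mem (b : Fin n ⊕ Fin n) (d : ℕ) {f : SymAlg n} (hf : f ∈ symDeg n d) :
    der n b f ∈ symDeg n (d - 1) := by
  cases d with
  | zero => rw [der_mem_zero b hf]; exact zero_mem _
  | succ d => exact der_mem_succ b d hf

theorem contr_mem (d : ℕ) {f : SymAlg n} (hf : f ∈ symDeg n d) :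
    contr n f ∈ symDeg n (d - 2) := by
  rw [contr, LinearMap.sum_apply]
  rw [← Nat.sub_sub d 1 1]
  exact sum_mem fun i _ => der_mem (.inl i) (d - 1) (der_mem (.inr i) d hf)

theorem matAct_apply (X : Mat n) (f : SymAlg n) :
    matAct n X f = ∑ a, ∑ b, X a b • (gen n a * der n b f) := by
  simp [matAct]

theorem matAct_mem (X : Mat n) (d : ℕ) {f : SymAlg n} (hf : f ∈ symDeg n d) :
    matAct n X f ∈ symDeg n d := by
  rw [matAct_apply]
  refine sum_mem fun a _ => sum_mem fun b _ => Submodule.smul_mem _ _ ?_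
  cases d with
  | zero => rw [der_mem_zero b hf, mul_zero]; exact zero_mem _
  | succ d => exact gen_mul_mem a (der_mem_succ b d hf)

theorem invol_mem (d : ℕ) {f : SymAlg n} (hf : f ∈ symDeg n d) : invol n f ∈ symDeg n d := by
  induction d generalizing f with
  | zero =>
    rw [symDeg_zero, Submodule.mem_span_singleton] at hf ⊢
    obtain ⟨c, rfl⟩ := hf
    exact ⟨c, by rw [map_smul, invol_one]⟩
  | succ d ih =>
    refine symDeg_succ_le (N := (symDeg n (d + 1)).comap (invol n)) (fun a g hg => ?_) hf
    have := LinearMap.congr_fun (invol_gen a) g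
    simp only [Module.End.mul_apply, LinearMap.mulLeft_apply, LinearMap.smul_apply] at this
    rw [Submodule.mem_comap, this]
    exact Submodule.smul_mem _ _ (gen_mul_mem a (ih hg))

theorem invol_der (b : Fin n ⊕ Fin n) :
    invol n * der n b = koszul (par b) 1 • (der n b * invol n) := by
  refine symAlg_ext fun p w => ?_
  rcases b with i | i
  · simp [invol, der, par, koszul, mapEnd_tm]
  · have h : ∀ w : ExteriorAlgebra ℂ (Fin n → ℂ),
        CliffordAlgebra.involute (CliffordAlgebra.contractLeft
          (Q := (0 : QuadraticForm ℂ (Fin n → ℂ))) (LinearMap.proj i) w) =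
        -CliffordAlgebra.contractLeft (Q := (0 : QuadraticForm ℂ (Fin n → ℂ))) (LinearMap.proj i)
          (CliffordAlgebra.involute w) := by
      intro w
      induction w using CliffordAlgebra.left_induction with
      | algebraMap r => simp
      | add x y hx hy => simp only [map_add, hx, hy]; abel
      | ι_mul x m hx =>
        rw [CliffordAlgebra.contractLeft_ι_mul, map_mul, map_sub, map_mul, map_smul, hx,
          CliffordAlgebra.involute_ι, neg_mul, neg_mul, map_neg,
          CliffordAlgebra.contractLeft_ι_mul]
        simp
    simp [invol, der, par, koszul, mapEnd_tm, h, map_neg]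

theorem invol_matAct {i : ZMod 2} {X : Mat n} (hX : X ∈ matGr n i) (f : SymAlg n) :
    invol n (matAct n X f) = koszul i 1 • matAct n X (invol n f) := by
  rw [matAct_apply, matAct_apply, map_sum, Finset.smul_sum]
  refine Finset.sum_congr rfl fun a _ => ?_
  rw [map_sum, Finset.smul_sum]
  refine Finset.sum_congr rfl fun b _ => ?_
  by_cases h : par a + par b = i
  · have h1 := LinearMap.congr_fun (invol_gen a) (der n b f)
    have h2 := LinearMap.congr_fun (invol_der b) f
    simp only [Module.End.mul_apply, LinearMap.mulLeft_apply, LinearMap.smul_apply] at h1 h2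
    rw [map_smul, h1, h2, ← h, koszul_add_left, mul_smul_comm]
    simp only [smul_smul]
    congr 1; ring
  · simp [hX a b h]

/-- The differential operator `y_a ∂/∂y_b`. -/
def elemOp (a b : Fin n ⊕ Fin n) : Module.End ℂ (SymAlg n) :=
  LinearMap.mulLeft ℂ (gen n a) * der n b

theorem elemOp_mul (a b c d : Fin n ⊕ Fin n) :
    elemOp a b * elemOp c d = (if b = c then (1 : ℂ) else 0) • elemOp a d +
      koszul (par c) (par b) • (LinearMap.mulLeft ℂ (gen n a) * LinearMap.mulLeft ℂ (gen n c) *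
        (der n b * der n d)) := by
  calc elemOp a b * elemOp c d
      = LinearMap.mulLeft ℂ (gen n a) * (der n b * LinearMap.mulLeft ℂ (gen n c)) * der n d := by
        simp only [elemOp, mul_assoc]
    _ = _ := by
        rw [der_gen, mul_add, add_mul]
        simp only [mul_smul_comm, smul_mul_assoc, mul_one, mul_assoc, elemOp]

theorem elemOp_comm (a b c d : Fin n ⊕ Fin n) :
    elemOp a b * elemOp c d - koszul (par a + par b) (par c + par d) • (elemOp c d * elemOp a b) =
      (if b = c then (1 : ℂ) else 0) • elemOp a d -
      (koszul (par a + par b) (par c + par d) * (if d = a then (1 : ℂ) else 0)) • elemOp c b := by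
  rw [elemOp_mul a b c d, elemOp_mul c d a b, gen_gen a c, der_der b d]
  simp only [smul_add, smul_mul_assoc, mul_smul_comm, smul_smul]
  have h : koszul (par c) (par b) * (koszul (par b) (par d) * koszul (par a) (par c)) =
      koszul (par a + par b) (par c + par d) * koszul (par a) (par d) := by
    rw [koszul_add_left, koszul_add_right, koszul_add_right, koszul_comm (par c)]
    have := koszul_sq (par a) (par d)
    linear_combination (-(koszul (par b) (par c) * koszul (par b) (par d) *
      koszul (par a) (par c))) * this
  rw [h]
  abel

theorem matAct_eq (X : Mat n) : matAct n X = ∑ a, ∑ b, X a b • elemOp a b := rfl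

theorem matAct_superComm {i j : ZMod 2} {X Y : Mat n} (hX : X ∈ matGr n i) (hY : Y ∈ matGr n j) :
    matAct n (superComm n X Y) =
      matAct n X * matAct n Y - koszul i j • (matAct n Y * matAct n X) := by
  have e1 : matAct n X * matAct n Y =
      ∑ a, ∑ b, ∑ c, ∑ d, (X a b * Y c d) • (elemOp a b * elemOp c d) := by
    rw [matAct_eq, matAct_eq, Finset.sum_mul]
    refine Finset.sum_congr rfl fun a _ => ?_
    rw [Finset.sum_mul]
    refine Finset.sum_congr rfl fun b _ => ?_
    rw [Finset.mul_sum]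
    refine Finset.sum_congr rfl fun c _ => ?_
    rw [Finset.mul_sum]
    refine Finset.sum_congr rfl fun d _ => ?_
    rw [smul_mul_smul_comm]
  have e2 : matAct n Y * matAct n X =
      ∑ a, ∑ b, ∑ c, ∑ d, (X a b * Y c d) • (elemOp c d * elemOp a b) := by
    rw [matAct_eq, matAct_eq, Finset.mul_sum]
    refine Finset.sum_congr rfl fun a _ => ?_
    rw [Finset.mul_sum]
    refine Finset.sum_congr rfl fun b _ => ?_
    rw [Finset.sum_mul]
    refine Finset.sum_congr rfl fun c _ => ?_
    rw [Finset.sum_mul]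
    refine Finset.sum_congr rfl fun d _ => ?_
    rw [smul_mul_smul_comm, mul_comm (Y c d)]
  have e3 : matAct n X * matAct n Y - koszul i j • (matAct n Y * matAct n X) =
      ∑ a, ∑ b, ∑ c, ∑ d, (X a b * Y c d) • ((if b = c then (1 : ℂ) else 0) • elemOp a d -
        (koszul i j * (if d = a then (1 : ℂ) else 0)) • elemOp c b) := by
    rw [e1, e2]
    rw [Finset.smul_sum, ← Finset.sum_sub_distrib]
    refine Finset.sum_congr rfl fun a _ => ?_
    rw [Finset.smul_sum, ← Finset.sum_sub_distrib]
    refine Finset.sum_congr rfl fun b _ => ?_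
    rw [Finset.smul_sum, ← Finset.sum_sub_distrib]
    refine Finset.sum_congr rfl fun c _ => ?_
    rw [Finset.smul_sum, ← Finset.sum_sub_distrib]
    refine Finset.sum_congr rfl fun d _ => ?_
    by_cases h1 : par a + par b = i
    · by_cases h2 : par c + par d = j
      · rw [← h1, ← h2, ← elemOp_comm, smul_sub, smul_comm (koszul _ _)]
      · simp [hY c d h2]
    · simp [hX a b h1]
  have f1 : matAct n (X * Y) = ∑ a, ∑ b, ∑ c, ∑ d,
      (X a b * Y c d * (if b = c then (1 : ℂ) else 0)) • elemOp a d := by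
    rw [matAct_eq]
    refine Finset.sum_congr rfl fun a _ => ?_
    have : ∀ b : Fin n ⊕ Fin n, (∑ c, ∑ d,
        (X a b * Y c d * (if b = c then (1 : ℂ) else 0)) • (elemOp a d : Module.End ℂ (SymAlg n))) =
        ∑ d, (X a b * Y b d) • elemOp a d := by
      intro b
      rw [Finset.sum_eq_single b]
      · simp
      · intro c _ hc; simp [Ne.symm hc]
      · simp
    simp only [this]
    rw [Finset.sum_comm]
    refine Finset.sum_congr rfl fun d _ => ?_
    rw [Matrix.mul_apply, Finset.sum_smul]
  have f2 : matAct n (Y * X) = ∑ a, ∑ b, ∑ c, ∑ d,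
      (X a b * Y c d * (if d = a then (1 : ℂ) else 0)) • elemOp c b := by
    have : ∀ a b c : Fin n ⊕ Fin n, (∑ d,
        (X a b * Y c d * (if d = a then (1 : ℂ) else 0)) • (elemOp c b : Module.End ℂ (SymAlg n))) =
        (Y c a * X a b) • elemOp c b := by
      intro a b c
      rw [Finset.sum_eq_single a]
      · simp [mul_comm]
      · intro d _ hd; simp [hd]
      · simp
    simp only [this]
    rw [matAct_eq, Finset.sum_comm]
    conv_rhs => rw [Finset.sum_comm]
    refine Finset.sum_congr rfl fun b _ => ?_
    conv_rhs => rw [Finset.sum_comm]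
    refine Finset.sum_congr rfl fun c _ => ?_
    rw [Matrix.mul_apply, Finset.sum_smul]
  rw [e3, superComm_apply hX hY, map_sub, map_smul, f1, f2]
  simp only [Finset.smul_sum, ← Finset.sum_sub_distrib, smul_sub, smul_smul]
  refine Finset.sum_congr rfl fun a _ => Finset.sum_congr rfl fun b _ =>
    Finset.sum_congr rfl fun c _ => Finset.sum_congr rfl fun d _ => ?_
  congr 2
  ring

end Stability

/-- The `d`-th symmetric power `S^d P_{n|n}` of the standard module, as a `𝔭(n)`-module. -/
def symPower (n d : ℕ) : SuperModule (periplectic n) where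
  carrier := symDeg n d
  gr i := (LinearMap.ker (invol n - koszul i 1 • 1)).comap (symDeg n d).subtype
  isCompl := by
    constructor
    · rw [Submodule.disjoint_def]
      rintro ⟨f, hf⟩ h0 h1
      have h0' : invol n f - koszul 0 1 • f = 0 := h0
      have h1' : invol n f - koszul 1 1 • f = 0 := h1
      ext1
      change f = 0
      have h2 : (2 : ℂ) • f = 0 := by
        have : (2 : ℂ) • f = (invol n f - koszul 1 1 • f) - (invol n f - koszul 0 1 • f) := by
          simp only [koszul]
          norm_num
          rw [two_smul]
        rw [this, h0', h1', sub_zero]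
      exact (smul_eq_zero.1 h2).resolve_left two_ne_zero
    · rw [codisjoint_iff, eq_top_iff]
      rintro ⟨f, hf⟩ -
      have hs : invol n (invol n f) = f := LinearMap.congr_fun invol_invol f
      refine Submodule.mem_sup.2
        ⟨⟨(2⁻¹ : ℂ) • (f + invol n f), Submodule.smul_mem _ _ (add_mem hf (invol_mem d hf))⟩, ?_,
          ⟨(2⁻¹ : ℂ) • (f - invol n f), Submodule.smul_mem _ _ (sub_mem hf (invol_mem d hf))⟩,
          ?_, ?_⟩
      · change invol n ((2⁻¹ : ℂ) • (f + invol n f)) - koszul 0 1 • (2⁻¹ : ℂ) • (f + invol n f) = 0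
        rw [map_smul, map_add, hs]
        simp only [koszul]
        norm_num
        rw [add_comm, sub_self]
      · change invol n ((2⁻¹ : ℂ) • (f - invol n f)) - koszul 1 1 • (2⁻¹ : ℂ) • (f - invol n f) = 0
        rw [map_smul, map_sub, hs]
        simp only [koszul]
        norm_num
        rw [← smul_add]
        simp
      · ext1
        change (2⁻¹ : ℂ) • (f + invol n f) + (2⁻¹ : ℂ) • (f - invol n f) = f
        rw [← smul_add, add_add_sub_cancel, ← two_smul ℂ f, smul_smul]
        norm_num
  ρ :=
    { toFun := fun X => (matAct n X.1).restrict fun _ hf => matAct_mem X.1 d hf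
      map_add' := by
        intro X Y; ext f
        change matAct n (X.1 + Y.1) f.1 = matAct n X.1 f.1 + matAct n Y.1 f.1
        rw [map_add]; rfl
      map_smul' := by
        intro c X; ext f
        change matAct n (c • X.1) f.1 = c • matAct n X.1 f.1
        rw [map_smul]; rfl }
  ρ_mem := by
    intro i j X hX f hf
    have hf' : invol n f.1 - koszul j 1 • f.1 = 0 := hf
    change invol n (matAct n X.1 f.1) - koszul (i + j) 1 • matAct n X.1 f.1 = 0
    have h := invol_matAct hX f.1
    rw [sub_eq_zero.1 hf', map_smul, smul_smul, ← koszul_add_left] at h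
    exact sub_eq_zero.2 h
  ρ_br := by
    intro i j X hX Y hY
    ext f
    change matAct n (superComm n X.1 Y.1) f.1 =
      matAct n X.1 (matAct n Y.1 f.1) - koszul i j • matAct n Y.1 (matAct n X.1 f.1)
    exact LinearMap.congr_fun (matAct_superComm hX hY) f.1

/-- The odd contraction `q : S^d P_{n|n} → S^{d-2} P_{n|n}` (it is zero for `d < 2`). -/
def oddContraction (n d : ℕ) : (symPower n d).carrier →ₗ[ℂ] (symPower n (d - 2)).carrier :=
  (contr n).restrict fun _ hf => contr_mem d hf

/-! ### Highest weights and the simple modules `L(μ)` -/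

/-- The element `diag(t₁, …, tₙ, -t₁, …, -tₙ)` of the Cartan subalgebra of `𝔭(n)`. -/
def cartan (n : ℕ) (t : Fin n → ℂ) : (periplectic n).carrier :=
  ⟨Matrix.diagonal (Sum.elim t (-t)), by
    refine ⟨fun i j => ?_, fun i j => ?_, fun i j => ?_⟩
    · by_cases h : i = j
      · subst h; simp
      · rw [Matrix.diagonal_apply_ne _ (by simpa using h),
          Matrix.diagonal_apply_ne _ (by simpa using Ne.symm h), neg_zero]
    · simp
    · simp⟩

/-- The weight space of weight `∑ i, μ i • ε_i`. -/
def weightSpace {n : ℕ} (M : SuperModule (periplectic n)) (μ : Fin n → ℂ) :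
    Submodule ℂ M.carrier where
  carrier := {v | ∀ t : Fin n → ℂ, M.ρ (cartan n t) v = (∑ i, μ i * t i) • v}
  add_mem' := by intro v w hv hw t; rw [map_add, hv, hw, smul_add]
  zero_mem' := by intro t; simp
  smul_mem' := by intro c v hv t; rw [map_smul, hv, smul_comm]

/-- The weight `ε_i`. -/
def eps {n : ℕ} (i : Fin n) : Fin n → ℂ := Pi.single i 1

/-- The positive roots for the Borel subalgebra of the matrices `[[A, B], [0, -Aᵗ]]` in `𝔭(n)`
with `A` upper triangular and `B` symmetric: `ε_i - ε_j` for `i < j` and `ε_i + ε_j` for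
`i ≤ j`. -/
def posRoots (n : ℕ) : Set (Fin n → ℂ) :=
  {α | ∃ i j : Fin n, (i < j ∧ α = eps i - eps j) ∨ (i ≤ j ∧ α = eps i + eps j)}

/-- `L` is (isomorphic to) `L(μ)`: a finite-dimensional simple module with highest weight `μ` (that
is, `μ` is a weight of `L`, and every weight of `L` differs from `μ` by a sum of positive roots),
whose highest weight vector is even. -/
structure IsL {n : ℕ} (μ : Fin n → ℂ) (L : SuperModule (periplectic n)) : Prop where
  finite : FiniteDimensional ℂ L.carrier
  simple : L.IsSimple
  even_vector : ∃ v ∈ weightSpace L μ, v ∈ L.gr 0 ∧ v ≠ 0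
  highest : ∀ ν : Fin n → ℂ, weightSpace L ν ≠ ⊥ → μ - ν ∈ AddSubmonoid.closure (posRoots n)

/-- `M ≅ Π^k L(μ)`. -/
def IsoShiftL {n : ℕ} (k : ℕ) (μ : Fin n → ℂ) (M : SuperModule (periplectic n)) : Prop :=
  ∃ L : SuperModule (periplectic n), IsL μ L ∧ M.Isomorphic (SuperModule.parityShift^[k] L)

end SuperLie

end

/-! Everything follows from two facts about the odd contraction `q = contr n`, which commutes up to
sign with 𝔭(n) and squares to zero.

Minimality (`contr_mem_of_invariant`): every nonzero 𝔭(n)-stable subspace `U` of `S^d V` contains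
`q(S^{d+2} V)`. The operators `x_i ∂/∂ξ_i` strip the odd variables from a nonzero vector of `U`, and
then `x_z ∂/∂x_j` turns all even variables into a single one, so `x_z^d ∈ U`; the operators `x_j
∂/∂x_z` now give every `x^a` of degree `d`. Finally `q(x^a ξ_L)` is reached by induction on the
length of `L`: a monomial with at least two factors `ξ` comes from a shorter one by an operator from
the block `C`, and `q` anticommutes with that operator. Hence `q(S^{d+2} V)` is the unique minimal
submodule, and in particular it is the socle.

Exactness (`ker_contr_eq_of_ne`, `ker_contr_le`, `xiTop_notMem`): let `s = ∑ x_i ξ_i`. On `S^d V`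
the anticommutator of `q` and multiplication by `s` acts on a monomial with `k` factors `ξ` as the
scalar `n + d - 2k`. Since `k ≤ n` and `k ≤ d`, this vanishes only for `k = d = n`, that is on
multiples of `ξ₁ ⋯ ξₙ`. So `ker q = im q` in degree `d ≠ n`, while in degree `n` the quotient `ker q
/ im q` is the line spanned by `ξ₁ ⋯ ξₙ`.

Maximality (`eq_top_of_not_le`) combines the two. If a submodule `N` of `S^d V`, `d ≥ 2`, is not
contained in `ker q`, then minimality in degree `d - 2`, applied to `q(N)`, gives `N + ker q = S^d
V`. Moreover `ker q ⊆ N`: this is minimality in degree `d` if `d ≠ n`, and for `d = n` one checks in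
addition that `ξ₁ ⋯ ξₙ ∈ N`. So `ker q` is the unique maximal submodule, hence the radical.

The submodules `0 < im q ≤ ker q < S^d V` therefore give the socle series, with a middle layer
exactly when `d = n`. The layers are recognised by the highest weight vectors `x₁^d`, `ξ₁ ⋯ ξₙ` and
`x₁^{d-1} ξ₁`; the bound on the weights in the outer layers is `weight_mem_closure`. -/

namespace SuperLie

open Finset

/-! ### Commutation relations of generators, derivations, the 𝔭(n)-operators and the contraction. -/

section Operators

variable {n : ℕ}

theorem gen_mul_gen_mul (a b : Fin n ⊕ Fin n) (f : SymAlg n) :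
    gen n a * (gen n b * f) = koszul (par a) (par b) • (gen n b * (gen n a * f)) := by
  simpa only [Module.End.mul_apply, LinearMap.mulLeft_apply, LinearMap.smul_apply] using
    LinearMap.congr_fun (gen_gen a b) f

theorem der_der_apply (a b : Fin n ⊕ Fin n) (f : SymAlg n) :
    der n a (der n b f) = koszul (par a) (par b) • der n b (der n a f) := by
  simpa only [Module.End.mul_apply, LinearMap.smul_apply] using LinearMap.congr_fun (der_der a b) f

theorem invol_gen_mul (a : Fin n ⊕ Fin n) (f : SymAlg n) :
    invol n (gen n a * f) = koszul (par a) 1 • (gen n a * invol n f) := by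
  simpa only [Module.End.mul_apply, LinearMap.mulLeft_apply, LinearMap.smul_apply] using
    LinearMap.congr_fun (invol_gen a) f

theorem invol_der_apply (a : Fin n ⊕ Fin n) (f : SymAlg n) :
    invol n (der n a f) = koszul (par a) 1 • der n a (invol n f) := by
  simpa only [Module.End.mul_apply, LinearMap.smul_apply] using LinearMap.congr_fun (invol_der a) f

theorem gen_inl_comm (i : Fin n) (b : Fin n ⊕ Fin n) (f : SymAlg n) :
    gen n (.inl i) * (gen n b * f) = gen n b * (gen n (.inl i) * f) := by
  rw [gen_mul_gen_mul]; simp [par, koszul]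

theorem gen_inr_anticomm (i j : Fin n) (f : SymAlg n) :
    gen n (.inr i) * (gen n (.inr j) * f) = -(gen n (.inr j) * (gen n (.inr i) * f)) := by
  rw [gen_mul_gen_mul]; simp [par, koszul]

theorem eq_zero_of_eq_neg {f : SymAlg n} (h : f = -f) : f = 0 := by
  have h2 : (2 : ℂ) • f = 0 := by
    rw [two_smul]; nth_rewrite 1 [h]; exact neg_add_cancel f
  exact (smul_eq_zero.1 h2).resolve_left two_ne_zero

theorem gen_inr_sq (i : Fin n) (f : SymAlg n) : gen n (.inr i) * (gen n (.inr i) * f) = 0 := by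
  exact eq_zero_of_eq_neg (gen_inr_anticomm i i f)

theorem der_inl_comm (i : Fin n) (b : Fin n ⊕ Fin n) (f : SymAlg n) :
    der n (.inl i) (der n b f) = der n b (der n (.inl i) f) := by
  rw [der_der_apply]; simp [par, koszul]

theorem der_inr_anticomm (i j : Fin n) (f : SymAlg n) :
    der n (.inr i) (der n (.inr j) f) = -der n (.inr j) (der n (.inr i) f) := by
  rw [der_der_apply]; simp [par, koszul]

theorem der_inr_sq (i : Fin n) (f : SymAlg n) : der n (.inr i) (der n (.inr i) f) = 0 :=
  eq_zero_of_eq_neg (der_inr_anticomm i i f)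

theorem der_inl_inl (i j : Fin n) (f : SymAlg n) :
    der n (.inl i) (gen n (.inl j) * f) =
      (if i = j then f else 0) + gen n (.inl j) * der n (.inl i) f := by
  rw [der_gen_mul]; simp [par, koszul]

theorem der_inl_inr (i j : Fin n) (f : SymAlg n) :
    der n (.inl i) (gen n (.inr j) * f) = gen n (.inr j) * der n (.inl i) f := by
  rw [der_gen_mul]; simp [par, koszul]

theorem der_inr_inl (i j : Fin n) (f : SymAlg n) :
    der n (.inr i) (gen n (.inl j) * f) = gen n (.inl j) * der n (.inr i) f := by
  rw [der_gen_mul]; simp [par, koszul]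

theorem der_inr_inr (i j : Fin n) (f : SymAlg n) :
    der n (.inr i) (gen n (.inr j) * f) =
      (if i = j then f else 0) - gen n (.inr j) * der n (.inr i) f := by
  rw [der_gen_mul]; simp [par, koszul, sub_eq_add_neg]

/-- Multiplication by `x_i` is injective. -/
theorem gen_inl_mul_injective (i : Fin n) :
    Function.Injective fun f : SymAlg n => gen n (.inl i) * f := by
  -- The polynomial ring is a domain, and tensoring with the exterior algebra, flat over the field,
  -- keeps multiplication by `x_i` injective.
  have h : Function.Injective (LinearMap.mulLeft ℂ (MvPolynomial.X i : MvPolynomial (Fin n) ℂ)) :=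
    fun a b hab => mul_left_cancel₀ (MvPolynomial.X_ne_zero i) hab
  have h2 := Module.Flat.rTensor_preserves_injective_linearMap
    (M := ExteriorAlgebra ℂ (Fin n → ℂ)) _ h
  have e : ∀ f : SymAlg n, gen n (.inl i) * f =
      mapEnd n (LinearMap.mulLeft ℂ (MvPolynomial.X i)) 1 f := by
    have : LinearMap.mulLeft ℂ (gen n (.inl i)) =
        mapEnd n (LinearMap.mulLeft ℂ (MvPolynomial.X i)) 1 := by
      refine symAlg_ext fun p w => ?_
      simp [gen, tm_mul, mapEnd_tm]
    exact fun f => LinearMap.congr_fun this f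
  intro a b hab
  simp only [e] at hab
  exact h2 hab

theorem gen_inl_mul_eq_zero {i : Fin n} {f : SymAlg n} (h : gen n (.inl i) * f = 0) : f = 0 :=
  gen_inl_mul_injective i (by simpa using h)

instance : Nontrivial (SymAlg n) :=
  inferInstanceAs (Nontrivial (MvPolynomial (Fin n) ℂ ⊗[ℂ] ExteriorAlgebra ℂ (Fin n → ℂ)))

/-- Euler's identity. -/
theorem euler {d : ℕ} {f : SymAlg n} (hf : f ∈ symDeg n d) :
    ∑ b, gen n b * der n b f = (d : ℂ) • f := by
  induction d generalizing f with
  | zero => simp [der_mem_zero _ hf]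
  | succ d ih =>
    let E : Module.End ℂ (SymAlg n) := ∑ b, LinearMap.mulLeft ℂ (gen n b) * der n b
    have hE : ∀ g, E g = ∑ b, gen n b * der n b g := fun g => by simp [E]
    have := symDeg_succ_le (n := n) (d := d) (N := LinearMap.ker (E - ((d + 1 : ℕ) : ℂ) • 1))
      (fun a g hg => ?_) hf
    · rw [← hE]
      simpa [sub_eq_zero] using this
    · have h1 : E (gen n a * g) = gen n a * g + gen n a * E g := by
        rw [hE, hE, mul_sum]
        simp only [der_gen_mul, mul_add, sum_add_distrib]
        congr 1
        · simp
        · refine sum_congr rfl fun b _ => ?_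
          rw [gen_mul_gen_mul a b, mul_smul_comm]
      rw [LinearMap.mem_ker, LinearMap.sub_apply, h1, hE, ih hg]
      simp [add_smul, add_comm]

theorem eq_zero_of_der_eq_zero {d : ℕ} {f : SymAlg n} (hd : d ≠ 0) (hf : f ∈ symDeg n d)
    (h : ∀ b, der n b f = 0) : f = 0 := by
  have := euler hf
  simp only [h, mul_zero, sum_const_zero] at this
  exact (smul_eq_zero.1 this.symm).resolve_left (by exact_mod_cast hd)

/-- The operator by which the element `E_{ij} - E_{n+j,n+i}` of `𝔭(n)` acts. -/
noncomputable def opA (i j : Fin n) : Module.End ℂ (SymAlg n) :=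
  elemOp (.inl i) (.inl j) - elemOp (.inr j) (.inr i)

/-- The operator by which the element `E_{i,n+j} + E_{j,n+i}` of `𝔭(n)` acts. -/
noncomputable def opB (i j : Fin n) : Module.End ℂ (SymAlg n) :=
  elemOp (.inl i) (.inr j) + elemOp (.inl j) (.inr i)

/-- The operator by which the element `E_{n+i,j} - E_{n+j,i}` of `𝔭(n)` acts. -/
noncomputable def opC (i j : Fin n) : Module.End ℂ (SymAlg n) :=
  elemOp (.inr i) (.inl j) - elemOp (.inr j) (.inl i)

theorem opA_apply (i j : Fin n) (f : SymAlg n) : opA i j f =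
    gen n (.inl i) * der n (.inl j) f - gen n (.inr j) * der n (.inr i) f := rfl

theorem opB_apply (i j : Fin n) (f : SymAlg n) : opB i j f =
    gen n (.inl i) * der n (.inr j) f + gen n (.inl j) * der n (.inr i) f := rfl

theorem opC_apply (i j : Fin n) (f : SymAlg n) : opC i j f =
    gen n (.inr i) * der n (.inl j) f - gen n (.inr j) * der n (.inl i) f := rfl

/-- A subspace of `S(V)` is invariant if it is stable under `𝔭(n)`. -/
structure Invariant (U : Submodule ℂ (SymAlg n)) : Prop where
  opA : ∀ i j, ∀ f ∈ U, opA i j f ∈ U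
  opB : ∀ i j, ∀ f ∈ U, opB i j f ∈ U
  opC : ∀ i j, ∀ f ∈ U, opC i j f ∈ U

theorem contr_apply (f : SymAlg n) :
    contr n f = ∑ i, der n (.inl i) (der n (.inr i) f) := by
  simp [contr]

theorem contr_inl (i : Fin n) (f : SymAlg n) : contr n (gen n (.inl i) * f) =
    der n (.inr i) f + gen n (.inl i) * contr n f := by
  simp only [contr_apply, der_inr_inl, der_inl_inl, sum_add_distrib, mul_sum]
  simp

theorem contr_inr (i : Fin n) (f : SymAlg n) : contr n (gen n (.inr i) * f) =
    der n (.inl i) f - gen n (.inr i) * contr n f := by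
  simp only [contr_apply, der_inr_inr, map_sub, der_inl_inr, sum_sub_distrib, mul_sum]
  simp [apply_ite]

theorem contr_der_inl (i : Fin n) (f : SymAlg n) :
    contr n (der n (.inl i) f) = der n (.inl i) (contr n f) := by
  simp only [contr_apply, map_sum]
  exact sum_congr rfl fun j _ => by rw [← der_inl_comm, der_inl_comm i (.inl j)]

theorem contr_der_inr (i : Fin n) (f : SymAlg n) :
    contr n (der n (.inr i) f) = -der n (.inr i) (contr n f) := by
  simp only [contr_apply, map_sum, ← sum_neg_distrib]
  exact sum_congr rfl fun j _ => by rw [der_inr_anticomm, map_neg, der_inl_comm]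

/-- This and the next two lemmas express the invariance of the odd form: being odd, the contraction
commutes with the even operators and anticommutes with the odd ones. -/
theorem contr_opA (i j : Fin n) (f : SymAlg n) : contr n (opA i j f) = opA i j (contr n f) := by
  simp only [opA_apply, map_sub, contr_inl, contr_inr, contr_der_inl, contr_der_inr,
    der_inl_comm j]
  simp

theorem contr_opB (i j : Fin n) (f : SymAlg n) : contr n (opB i j f) = -opB i j (contr n f) := by
  simp only [opB_apply, map_add, contr_inl, contr_der_inr, der_inr_anticomm j i]
  simp only [mul_neg]
  abel

theorem contr_opC (i j : Fin n) (f : SymAlg n) : contr n (opC i j f) = -opC i j (contr n f) := by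
  simp only [opC_apply, map_sub, contr_inr, contr_der_inl, der_inl_comm j]
  simp

/-- The contraction is odd and its terms supercommute, so its square equals its own negative. -/
theorem contr_contr (f : SymAlg n) : contr n (contr n f) = 0 := by
  have : contr n (contr n f) = -contr n (contr n f) := by
    conv_lhs => rw [contr_apply f, map_sum]
    simp only [contr_der_inl, contr_der_inr, map_neg, sum_neg_distrib]
    rw [← contr_apply]
  exact eq_zero_of_eq_neg this

theorem contr_invol (f : SymAlg n) : contr n (invol n f) = -invol n (contr n f) := by
  simp only [contr_apply, map_sum, ← sum_neg_distrib]
  refine sum_congr rfl fun i _ => ?_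
  rw [invol_der_apply, invol_der_apply, map_smul]
  simp [par, koszul]

end Operators

/-! ### The spanning monomials `x^a ξ_L`. -/

section Monomials

variable {n : ℕ}

/-- The monomial `x^a ξ_{i₁} ⋯ ξ_{iₖ}`, where `L = [i₁, …, iₖ]`. -/
noncomputable def mon (a : Fin n →₀ ℕ) (L : List (Fin n)) : SymAlg n :=
  tm n (MvPolynomial.monomial a 1) (L.map fun i => ExteriorAlgebra.ι ℂ (Pi.single i 1)).prod

theorem mon_zero_nil : mon (n := n) 0 [] = 1 := by simp [mon, tm_one]

theorem gen_inl_mul_mon (i : Fin n) (a : Fin n →₀ ℕ) (L : List (Fin n)) :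
    gen n (.inl i) * mon a L = mon (a + Finsupp.single i 1) L := by
  rw [mon, mon, gen, tm_mul, MvPolynomial.X, MvPolynomial.monomial_mul]
  simp [add_comm]

theorem gen_inr_mul_mon (i : Fin n) (a : Fin n →₀ ℕ) (L : List (Fin n)) :
    gen n (.inr i) * mon a L = mon a (i :: L) := by
  rw [mon, mon, gen, tm_mul]
  simp

theorem der_inl_mon (i : Fin n) (a : Fin n →₀ ℕ) (L : List (Fin n)) :
    der n (.inl i) (mon a L) = (a i : ℂ) • mon (a - Finsupp.single i 1) L := by
  rw [mon, der, mapEnd_tm, mon]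
  have : (MvPolynomial.pderiv i).toLinearMap (MvPolynomial.monomial a (1 : ℂ)) =
      (a i : ℂ) • MvPolynomial.monomial (a - Finsupp.single i 1) 1 := by
    rw [MvPolynomial.smul_monomial, smul_eq_mul, mul_comm]
    exact MvPolynomial.pderiv_monomial
  rw [this, map_smul]
  rfl

theorem der_inr_mon_nil (i : Fin n) (a : Fin n →₀ ℕ) : der n (.inr i) (mon a []) = 0 := by
  simp [mon, der, mapEnd_tm]

theorem mon_cons_of_mem {i : Fin n} {L : List (Fin n)} (h : i ∈ L) (a : Fin n →₀ ℕ) :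
    mon a (i :: L) = 0 := by
  induction L with
  | nil => simp at h
  | cons j L ih =>
    rw [← gen_inr_mul_mon, ← gen_inr_mul_mon]
    rcases List.mem_cons.1 h with rfl | h
    · exact gen_inr_sq _ _
    · rw [gen_inr_anticomm, gen_inr_mul_mon, ih h, mul_zero, neg_zero]

theorem mon_eq_zero_of_not_nodup {L : List (Fin n)} (h : ¬ L.Nodup) (a : Fin n →₀ ℕ) :
    mon a L = 0 := by
  induction L with
  | nil => simp at h
  | cons i L ih =>
    by_cases hi : i ∈ L
    · exact mon_cons_of_mem hi a
    · rw [← gen_inr_mul_mon, ih fun h' => h (List.nodup_cons.2 ⟨hi, h'⟩), mul_zero]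

/-- Reordering the odd factors changes a monomial only by a sign. -/
theorem mon_mem_span_of_perm {L L' : List (Fin n)} (h : L.Perm L') (a : Fin n →₀ ℕ) :
    mon a L ∈ Submodule.span ℂ {mon a L'} := by
  induction h with
  | nil => exact Submodule.mem_span_singleton_self _
  | cons i _ ih =>
    obtain ⟨c, hc⟩ := Submodule.mem_span_singleton.1 ih
    exact Submodule.mem_span_singleton.2
      ⟨c, by rw [← gen_inr_mul_mon, ← gen_inr_mul_mon, ← hc, mul_smul_comm]⟩
  | swap i j L =>
    refine Submodule.mem_span_singleton.2 ⟨-1, ?_⟩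
    simp only [← gen_inr_mul_mon]
    rw [gen_inr_anticomm]; simp
  | trans _ _ h1 h2 =>
    obtain ⟨c, hc⟩ := Submodule.mem_span_singleton.1 h1
    rw [← hc]
    exact Submodule.smul_mem _ _ h2

theorem der_inr_mon_of_notMem {i : Fin n} {L : List (Fin n)} (h : i ∉ L) (a : Fin n →₀ ℕ) :
    der n (.inr i) (mon a L) = 0 := by
  induction L with
  | nil => exact der_inr_mon_nil i a
  | cons j L ih =>
    rw [List.mem_cons, not_or] at h
    rw [← gen_inr_mul_mon, der_inr_inr, ih h.2]
    simp [h.1]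

theorem exists_add_single {a : Fin n →₀ ℕ} {i : Fin n} (h : a i ≠ 0) :
    ∃ b, a = b + Finsupp.single i 1 :=
  ⟨a - Finsupp.single i 1, (Finsupp.sub_add_single_one_cancel h).symm⟩

theorem mon_nil_ne_zero (a : Fin n →₀ ℕ) : mon a [] ≠ 0 := by
  induction hd : a.degree generalizing a with
  | zero =>
    obtain rfl : a = 0 := (Finsupp.degree_eq_zero_iff a).1 hd
    rw [mon_zero_nil]; exact one_ne_zero
  | succ d ih =>
    obtain ⟨i, hi⟩ : ∃ i, a i ≠ 0 := by
      by_contra! h0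
      obtain rfl : a = 0 := Finsupp.ext h0
      simp at hd
    obtain ⟨b, rfl⟩ := exists_add_single hi
    rw [← gen_inl_mul_mon]
    exact fun h => ih b (by simpa using hd) (gen_inl_mul_eq_zero h)

/-- When `i ∉ L`, the derivation `∂/∂ξ_i` undoes multiplication by a leading `ξ_i`, which reduces to
the case of a power product of the `x_i`. -/
theorem mon_ne_zero {L : List (Fin n)} (h : L.Nodup) (a : Fin n →₀ ℕ) : mon a L ≠ 0 := by
  induction L with
  | nil => exact mon_nil_ne_zero a
  | cons i L ih =>
    rw [List.nodup_cons] at h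
    intro h0
    have := congrArg (der n (.inr i)) h0
    rw [← gen_inr_mul_mon, der_inr_inr, der_inr_mon_of_notMem h.1] at this
    exact ih h.2 (by simpa using this)

theorem mon_mem {d : ℕ} {a : Fin n →₀ ℕ} {L : List (Fin n)} (h : a.degree + L.length = d) :
    mon a L ∈ symDeg n d := by
  induction L generalizing d with
  | nil =>
    induction d generalizing a with
    | zero =>
      obtain rfl : a = 0 := by rw [← Finsupp.degree_eq_zero_iff]; simpa using h
      rw [mon_zero_nil, symDeg_zero]
      exact Submodule.mem_span_singleton_self _
    | succ d ih =>
      obtain ⟨i, hi⟩ : ∃ i, a i ≠ 0 := by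
        by_contra! h0
        obtain rfl : a = 0 := Finsupp.ext h0
        simp at h
      obtain ⟨b, rfl⟩ := exists_add_single hi
      rw [← gen_inl_mul_mon]
      exact gen_mul_mem _ (ih (by simpa [← add_assoc] using h))
  | cons i L ih =>
    obtain _ | d := d
    · simp at h
    · rw [← gen_inr_mul_mon]
      exact gen_mul_mem _ (ih (by simpa [← add_assoc] using h))

/-- Inclusions are tested on monomials. The list `L` may have repetitions, in which case the
monomial is zero. -/
theorem symDeg_le_of_mon {d : ℕ} {N : Submodule ℂ (SymAlg n)}
    (h : ∀ (a : Fin n →₀ ℕ) (L : List (Fin n)), a.degree + L.length = d → mon a L ∈ N) :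
    symDeg n d ≤ N := by
  induction d generalizing N with
  | zero =>
    rw [symDeg_zero, Submodule.span_singleton_le_iff_mem, ← mon_zero_nil]
    exact h 0 [] (by simp)
  | succ d ih =>
    refine symDeg_succ_le fun b f hf => ?_
    refine ih (N := N.comap (LinearMap.mulLeft ℂ (gen n b))) (fun a L haL => ?_) hf
    rw [Submodule.mem_comap, LinearMap.mulLeft_apply]
    rcases b with i | i
    · rw [gen_inl_mul_mon]
      exact h _ _ (by simp; omega)
    · rw [gen_inr_mul_mon]
      exact h _ _ (by simp; omega)

theorem sum_gen_der_inr_mon (a : Fin n →₀ ℕ) (L : List (Fin n)) :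
    ∑ i, gen n (.inr i) * der n (.inr i) (mon a L) = (L.length : ℂ) • mon a L := by
  induction L with
  | nil => simp [der_inr_mon_nil]
  | cons j L ih =>
    simp only [← gen_inr_mul_mon j a L, der_inr_inr, mul_sub, sum_sub_distrib]
    simp only [gen_inr_anticomm _ j, sum_neg_distrib, ← mul_sum, ih]
    simp [add_smul, add_comm]

end Monomials

/-! ### Every nonzero invariant subspace contains the image of the contraction. -/

section Generation

variable {n : ℕ}

/-- The second term of the operator contributes nothing because `ξ_j² = 0`. The formula lengthens
the odd part of a monomial that already has a factor `ξ_j`; it drives the induction in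
`contr_mon_mem` and later produces `ξ₁ ⋯ ξₙ`. -/
theorem opC_mon (i j : Fin n) (a : Fin n →₀ ℕ) (L : List (Fin n)) :
    opC i j (mon (a + Finsupp.single j 1) (j :: L)) = ((a j : ℂ) + 1) • mon a (i :: j :: L) := by
  have h : gen n (.inr j) * mon (a + Finsupp.single j 1 - Finsupp.single i 1) (j :: L) = 0 := by
    rw [gen_inr_mul_mon, mon_cons_of_mem List.mem_cons_self]
  rw [opC_apply, der_inl_mon, der_inl_mon, mul_smul_comm, mul_smul_comm, h, gen_inr_mul_mon]
  simp

/-- The odd variables are removed one at a time: if `∂f/∂ξ_i ≠ 0`, replace `f` by `x_i ∂f/∂ξ_i`,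
which stays nonzero because multiplication by `x_i` is injective. -/
theorem exists_der_inr_eq_zero {U : Submodule ℂ (SymAlg n)} (hU : Invariant U) (h : U ≠ ⊥) :
    ∃ f ∈ U, f ≠ 0 ∧ ∀ i, der n (.inr i) f = 0 := by
  have key : ∀ s : Finset (Fin n), ∃ f ∈ U, f ≠ 0 ∧ ∀ i ∈ s, der n (.inr i) f = 0 := by
    intro s
    induction s using Finset.induction_on with
    | empty =>
      obtain ⟨f, hf, h0⟩ := Submodule.exists_mem_ne_zero_of_ne_bot h
      exact ⟨f, hf, h0, by simp⟩
    | insert i s _ ih =>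
      obtain ⟨f, hf, h0, hs⟩ := ih
      by_cases hi : der n (.inr i) f = 0
      · exact ⟨f, hf, h0, by simpa [hi] using hs⟩
      -- This vector is half of `opB i i f`.
      · refine ⟨gen n (.inl i) * der n (.inr i) f, ?_, fun h => hi (gen_inl_mul_eq_zero h), ?_⟩
        · have h2 := hU.opB i i f hf
          rw [opB_apply, ← two_smul ℂ] at h2
          exact (Submodule.smul_mem_iff _ two_ne_zero).1 h2
        · intro j hj
          rw [der_inr_inl]
          rcases Finset.mem_insert.1 hj with rfl | hj
          · rw [der_inr_sq, mul_zero]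
          · rw [der_inr_anticomm, hs j hj, map_zero, neg_zero, mul_zero]
  obtain ⟨f, hf, h0, hs⟩ := key univ
  exact ⟨f, hf, h0, fun i => hs i (mem_univ i)⟩

/-- On vectors free of odd variables `opA z j` acts as `x_z ∂/∂x_j`, which lowers the degree in
`x_j` without reintroducing variables already removed. The exponent `m` bounds the number of
repetitions, and the process stops just before the vector would become zero. -/
theorem exists_der_eq_zero_of_pow {U : Submodule ℂ (SymAlg n)} (hU : Invariant U) (z j : Fin n)
    (hj : j ≠ z) (s : Set (Fin n)) (m : ℕ) : ∀ f ∈ U, f ≠ 0 → (∀ i, der n (.inr i) f = 0) →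
      (∀ i ∈ s, i ≠ z → der n (.inl i) f = 0) → (der n (.inl j) ^ m) f = 0 →
      ∃ g ∈ U, g ≠ 0 ∧ (∀ i, der n (.inr i) g = 0) ∧
        (∀ i ∈ s, i ≠ z → der n (.inl i) g = 0) ∧ der n (.inl j) g = 0 := by
  induction m with
  | zero => intro f _ h0 _ _ hm; exact absurd (by simpa using hm) h0
  | succ m ih =>
    intro f hf h0 h1 h2 hm
    by_cases hjf : der n (.inl j) f = 0
    · exact ⟨f, hf, h0, h1, h2, hjf⟩
    · have hmem : gen n (.inl z) * der n (.inl j) f ∈ U := by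
        have := hU.opA z j f hf
        rwa [opA_apply, h1, mul_zero, sub_zero] at this
      have hcomm : ∀ (k : ℕ) (g : SymAlg n), (der n (.inl j) ^ k) (gen n (.inl z) * g) =
          gen n (.inl z) * (der n (.inl j) ^ k) g := by
        intro k
        induction k with
        | zero => simp
        | succ k ihk => intro g; rw [pow_succ, Module.End.mul_apply, der_inl_inl, if_neg hj,
            zero_add, ihk, Module.End.mul_apply]
      refine ih _ hmem (fun h => hjf (gen_inl_mul_eq_zero h)) (fun i => ?_) (fun i hi hiz => ?_) ?_
      · rw [der_inr_inl, ← der_inl_comm, h1, map_zero, mul_zero]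
      · rw [der_inl_inl, if_neg hiz, zero_add, der_inl_comm, h2 i hi hiz, map_zero, mul_zero]
      · rw [hcomm, ← Module.End.mul_apply, ← pow_succ, hm, mul_zero]

theorem der_pow_eq_zero {d : ℕ} (b : Fin n ⊕ Fin n) {f : SymAlg n} (hf : f ∈ symDeg n d) :
    (der n b ^ (d + 1)) f = 0 := by
  induction d generalizing f with
  | zero => simpa using der_mem_zero b hf
  | succ d ih => rw [pow_succ, Module.End.mul_apply]; exact ih (der_mem_succ b d hf)

/-- In Euler's identity only the term of `x_z` survives, so `f` is a multiple of `x_z ∂f/∂x_z`, and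
induction on the degree applies. -/
theorem mem_span_of_der_eq_zero {d : ℕ} (z : Fin n) {f : SymAlg n} (hf : f ∈ symDeg n d)
    (h : ∀ b, b ≠ .inl z → der n b f = 0) :
    f ∈ Submodule.span ℂ {mon (Finsupp.single z d) []} := by
  induction d generalizing f with
  | zero => rw [Finsupp.single_zero, mon_zero_nil, ← symDeg_zero]; exact hf
  | succ d ih =>
    have he := euler hf
    rw [sum_eq_single (.inl z) (fun b _ hb => by rw [h b hb, mul_zero]) (by simp)] at he
    obtain ⟨c, hc⟩ := Submodule.mem_span_singleton.1 (ih (der_mem_succ (.inl z) d hf)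
      fun b hb => by rw [← der_inl_comm, h b hb, map_zero])
    rw [← hc, mul_smul_comm, gen_inl_mul_mon, ← Finsupp.single_add] at he
    refine (Submodule.smul_mem_iff _ (Nat.cast_ne_zero (R := ℂ).2 d.succ_ne_zero)).1 ?_
    rw [← he]
    exact Submodule.smul_mem _ _ (Submodule.mem_span_singleton_self _)

theorem mon_single_mem {d : ℕ} {U : Submodule ℂ (SymAlg n)} (hU : Invariant U)
    (hd : U ≤ symDeg n d) (h : U ≠ ⊥) (z : Fin n) : mon (Finsupp.single z d) [] ∈ U := by
  have key : ∀ s : Finset (Fin n), ∃ f ∈ U, f ≠ 0 ∧ (∀ i, der n (.inr i) f = 0) ∧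
      ∀ i ∈ s, i ≠ z → der n (.inl i) f = 0 := by
    intro s
    induction s using Finset.induction_on with
    | empty =>
      obtain ⟨f, hf, h0, h1⟩ := exists_der_inr_eq_zero hU h
      exact ⟨f, hf, h0, h1, by simp⟩
    | insert j s _ ih =>
      obtain ⟨f, hf, h0, h1, h2⟩ := ih
      by_cases hj : j = z
      · subst hj
        refine ⟨f, hf, h0, h1, fun i hi hiz => h2 i ?_ hiz⟩
        exact (Finset.mem_insert.1 hi).resolve_left hiz
      · obtain ⟨g, hg, g0, g1, g2, g3⟩ := exists_der_eq_zero_of_pow hU z j hj s (d + 1) f hf h0 h1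
          h2 (der_pow_eq_zero _ (hd hf))
        refine ⟨g, hg, g0, g1, fun i hi hiz => ?_⟩
        rcases Finset.mem_insert.1 hi with rfl | hi
        · exact g3
        · exact g2 i hi hiz
  obtain ⟨f, hf, h0, h1, h2⟩ := key univ
  obtain ⟨c, rfl⟩ := Submodule.mem_span_singleton.1 (mem_span_of_der_eq_zero z (hd hf) (by
    rintro (i | i) hi
    · exact h2 i (mem_univ i) fun h => hi (by rw [h])
    · exact h1 i))
  exact (Submodule.smul_mem_iff _ (fun hc => h0 (by rw [hc, zero_smul]))).1 hf

/-- The induction variable `m` is the number of factors different from `x_z`. Each step trades one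
`x_z` for some `x_j` by means of `opA j z`, with a nonzero integer coefficient. -/
theorem mon_nil_mem {d : ℕ} {U : Submodule ℂ (SymAlg n)} (hU : Invariant U) (z : Fin n)
    (h : mon (Finsupp.single z d) [] ∈ U) (m : ℕ) :
    ∀ a : Fin n →₀ ℕ, a.degree = d → a z + m = d → mon a [] ∈ U := by
  induction m with
  | zero =>
    intro a ha hz
    have hb : a - Finsupp.single z (a z) = 0 := by
      rw [← Finsupp.degree_eq_zero_iff]
      have h1 : (a - Finsupp.single z (a z)) + Finsupp.single z (a z) = a := by
        ext i
        by_cases hi : i = z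
        · subst hi; simp
        · simp [Ne.symm hi]
      have := congrArg Finsupp.degree h1
      rw [map_add, Finsupp.degree_single] at this
      omega
    have : a = Finsupp.single z d := by
      ext i
      have := DFunLike.congr_fun hb i
      by_cases hi : i = z
      · subst hi; simpa using hz
      · simpa [hi] using this
    rwa [this]
  | succ m ih =>
    intro a ha hz
    obtain ⟨j, hj, hjz⟩ : ∃ j, a j ≠ 0 ∧ j ≠ z := by
      by_contra! h0
      have : a = Finsupp.single z (a z) := by
        ext i
        by_cases hi : i = z
        · subst hi; simp
        · have := mt (h0 i) hi
          simpa [hi] using this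
      have := congrArg Finsupp.degree this
      rw [Finsupp.degree_single] at this
      omega
    obtain ⟨b, rfl⟩ := exists_add_single hj
    have hb : mon (b + Finsupp.single z 1) [] ∈ U := by
      refine ih _ (by simpa using ha) ?_
      simp [hjz] at hz ⊢
      omega
    have h2 := hU.opA j z _ hb
    rw [opA_apply, der_inr_mon_nil, mul_zero, sub_zero, der_inl_mon, mul_smul_comm,
      gen_inl_mul_mon, add_tsub_cancel_right] at h2
    exact (Submodule.smul_mem_iff _ (by simp [Nat.cast_add_one_ne_zero])).1 h2

/-- Induction on the number of odd factors: none gives zero, one gives a multiple of a pure power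
product, and from two on the monomial is a multiple of some `opC i j` applied to a shorter one, to
which the contraction passes up to sign. -/
theorem contr_mon_mem {d : ℕ} {U : Submodule ℂ (SymAlg n)} (hU : Invariant U)
    (h : ∀ a : Fin n →₀ ℕ, a.degree = d → mon a [] ∈ U) (L : List (Fin n)) :
    ∀ a : Fin n →₀ ℕ, a.degree + L.length = d + 2 → contr n (mon a L) ∈ U := by
  induction L with
  | nil => intro a _; simp [contr_apply, der_inr_mon_nil]
  | cons i L ih =>
    intro a ha
    rcases L with _ | ⟨j, L⟩
    · rw [← gen_inr_mul_mon, contr_inr, contr_apply]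
      simp only [der_inr_mon_nil, map_zero, sum_const_zero, mul_zero, sub_zero, der_inl_mon]
      by_cases hi : a i = 0
      · simp [hi]
      · obtain ⟨b, rfl⟩ := exists_add_single hi
        refine Submodule.smul_mem _ _ (h _ ?_)
        simp at ha ⊢
        omega
    -- The shorter monomial gains a factor `x_j`, so its total degree is still `d + 2`.
    · have h1 := hU.opC i j _ (ih (a + Finsupp.single j 1) (by simp at ha ⊢; omega))
      rw [← neg_neg (opC i j _), ← contr_opC, opC_mon, map_smul] at h1
      exact (Submodule.smul_mem_iff _ (Nat.cast_add_one_ne_zero _)).1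
        (neg_mem_iff.1 h1)

/-- Every nonzero `𝔭(n)`-submodule of `S^d V` contains the image of the contraction. -/
theorem contr_mem_of_invariant {d : ℕ} {U : Submodule ℂ (SymAlg n)} (hU : Invariant U)
    (hd : U ≤ symDeg n d) (h : U ≠ ⊥) (hn : 1 ≤ n) :
    (symDeg n (d + 2)).map (contr n) ≤ U := by
  rw [Submodule.map_le_iff_le_comap]
  let z : Fin n := ⟨0, hn⟩
  refine symDeg_le_of_mon fun a L haL => contr_mon_mem hU (fun a ha => ?_) L a haL
  refine mon_nil_mem hU z (mon_single_mem hU hd h z) (d - a z) a ha ?_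
  have := Finsupp.le_degree z a
  omega

end Generation

/-! ### Kernel versus image of the contraction, by a homotopy argument. -/

section Kernel

variable {n : ℕ}

/-- The operator counting the number of factors `ξ_i`. -/
noncomputable def oddDegree (n : ℕ) : Module.End ℂ (SymAlg n) := ∑ i, elemOp (.inr i) (.inr i)

theorem oddDegree_apply (f : SymAlg n) :
    oddDegree n f = ∑ i, gen n (.inr i) * der n (.inr i) f := by
  simp [oddDegree, elemOp]

theorem oddDegree_mon (a : Fin n →₀ ℕ) (L : List (Fin n)) :
    oddDegree n (mon a L) = (L.length : ℂ) • mon a L := by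
  rw [oddDegree_apply, sum_gen_der_inr_mon]

/-- The contraction removes exactly one odd factor. -/
theorem contr_oddDegree (f : SymAlg n) :
    contr n (oddDegree n f) = contr n f + oddDegree n (contr n f) := by
  rw [oddDegree_apply, oddDegree_apply, map_sum]
  conv_rhs => rw [contr_apply, ← sum_add_distrib]
  simp only [contr_inr, contr_der_inr, mul_neg, sub_neg_eq_add]
  simp only [← contr_apply]

/-- The element `∑ i, x_i ξ_i`. -/
noncomputable def sumXi (n : ℕ) : SymAlg n := ∑ i, gen n (.inl i) * gen n (.inr i)

theorem sumXi_mul_mem {d : ℕ} {f : SymAlg n} (hf : f ∈ symDeg n d) :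
    sumXi n * f ∈ symDeg n (d + 2) := by
  rw [sumXi, sum_mul]
  refine sum_mem fun i _ => ?_
  rw [mul_assoc]
  exact gen_mul_mem _ (gen_mul_mem _ hf)

/-- The scalar `n + d` minus twice the odd degree; on `S^d V` it is the anticommutator of the
contraction and the multiplication by `∑ i, x_i ξ_i`. -/
noncomputable def homotopyOp (n d : ℕ) : Module.End ℂ (SymAlg n) :=
  ((n : ℂ) + d) • 1 - (2 : ℂ) • oddDegree n

theorem homotopyOp_apply (d : ℕ) (f : SymAlg n) :
    homotopyOp n d f = ((n : ℂ) + d) • f - (2 : ℂ) • oddDegree n f := rfl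

/-- The commutation relations give `n - N + ∑ x_i ∂/∂x_i` for the anticommutator, where `N` is the
odd degree operator; Euler's identity replaces the last sum by `d - N`. -/
theorem contr_sumXi_mul {d : ℕ} {f : SymAlg n} (hf : f ∈ symDeg n d) :
    contr n (sumXi n * f) + sumXi n * contr n f = homotopyOp n d f := by
  have he := euler hf
  rw [Fintype.sum_sum_type, ← oddDegree_apply, ← eq_sub_iff_add_eq] at he
  have h : contr n (sumXi n * f) + sumXi n * contr n f =
      (n : ℂ) • f - oddDegree n f + ∑ i, gen n (.inl i) * der n (.inl i) f := by
    simp only [sumXi, sum_mul, map_sum, mul_assoc, contr_inl, contr_inr, der_inr_inr, mul_sub,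
      if_true, sum_add_distrib, sum_sub_distrib, oddDegree_apply]
    simp [Nat.cast_smul_eq_nsmul]
    abel
  rw [h, he, homotopyOp_apply]
  module

theorem homotopyOp_mon (d : ℕ) (a : Fin n →₀ ℕ) (L : List (Fin n)) :
    homotopyOp n d (mon a L) = ((n : ℂ) + d - 2 * L.length) • mon a L := by
  rw [homotopyOp_apply, oddDegree_mon]
  module

/-- The sum of the eigenspaces of `homotopyOp n d` with nonzero eigenvalue. -/
noncomputable def homotopyRange (n d : ℕ) : Submodule ℂ (SymAlg n) :=
  ⨆ (μ : ℂ) (_ : μ ≠ 0), (homotopyOp n d).eigenspace μ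

theorem mem_homotopyRange {d : ℕ} {μ : ℂ} (hμ : μ ≠ 0) {f : SymAlg n}
    (h : homotopyOp n d f = μ • f) : f ∈ homotopyRange n d :=
  Submodule.mem_iSup_of_mem μ (Submodule.mem_iSup_of_mem hμ (Module.End.mem_eigenspace_iff.2 h))

theorem eq_zero_of_mem_homotopyRange {d : ℕ} {f : SymAlg n} (hf : f ∈ homotopyRange n d)
    (h : homotopyOp n d f = 0) : f = 0 :=
  Submodule.disjoint_def.1 ((Module.End.eigenspaces_iSupIndep (homotopyOp n d)) 0) f
    (Module.End.mem_eigenspace_iff.2 (by rw [h, zero_smul])) hf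

theorem homotopyOp_mem {d : ℕ} {f : SymAlg n} (hf : f ∈ homotopyRange n d) :
    homotopyOp n d f ∈ homotopyRange n d := by
  have : homotopyRange n d ≤ (homotopyRange n d).comap (homotopyOp n d) := by
    refine iSup₂_le fun μ hμ g hg => ?_
    have hg' := Module.End.mem_eigenspace_iff.1 hg
    rw [Submodule.mem_comap, hg']
    exact Submodule.smul_mem _ _ (mem_homotopyRange hμ hg')
  exact this hf

instance (d : ℕ) : FiniteDimensional ℂ (symDeg n d) :=
  Module.Finite.iff_fg.2 ((Submodule.fg_span (Set.finite_range _)).pow d)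

/-- On the part of `ker q` without zero eigenvalues, the homotopy operator is `g ↦ q(s g)` and maps
this space injectively to itself. By finite dimension it is onto, so every such `f` is some `q(s
g)`. -/
theorem mem_map_contr_of_homotopyRange {d : ℕ} {f : SymAlg n} (hf : f ∈ symDeg n d)
    (hq : contr n f = 0) (hY : f ∈ homotopyRange n d) :
    f ∈ (symDeg n (d + 2)).map (contr n) := by
  let M : Submodule ℂ (SymAlg n) := symDeg n d ⊓ LinearMap.ker (contr n) ⊓ homotopyRange n d
  have hT : ∀ g ∈ M, homotopyOp n d g = contr n (sumXi n * g) := by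
    rintro g ⟨⟨h1, h2⟩, -⟩
    rw [← contr_sumXi_mul h1, LinearMap.mem_ker.1 h2, mul_zero, add_zero]
  have hM : ∀ g ∈ M, homotopyOp n d g ∈ M := by
    intro g hg
    refine ⟨?_, homotopyOp_mem hg.2⟩
    rw [hT g hg]
    exact ⟨contr_mem (d + 2) (sumXi_mul_mem hg.1.1), contr_contr _⟩
  have : FiniteDimensional ℂ M :=
    Submodule.finiteDimensional_of_le (inf_le_left.trans inf_le_left : M ≤ symDeg n d)
  have hinj : Function.Injective ((homotopyOp n d).restrict hM) := by
    rw [injective_iff_map_eq_zero]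
    rintro ⟨g, hg⟩ h0
    exact Subtype.ext (eq_zero_of_mem_homotopyRange hg.2 (congrArg Subtype.val h0))
  obtain ⟨⟨g, hg⟩, hgf⟩ := LinearMap.surjective_of_injective hinj ⟨f, ⟨hf, hq⟩, hY⟩
  have h1 : homotopyOp n d g = f := congrArg Subtype.val hgf
  exact ⟨sumXi n * g, sumXi_mul_mem hg.1.1, by rw [← hT g hg, h1]⟩

theorem length_le_of_nodup {L : List (Fin n)} (h : L.Nodup) : L.length ≤ n := by
  simpa using h.length_le_card

/-- The eigenvalue `n + d - 2k` on a nonzero monomial with `k` odd factors vanishes only if `k = n =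
d`, as `k` is at most both `n` and `d`. -/
theorem symDeg_le_homotopyRange {d : ℕ} (hd : d ≠ n) : symDeg n d ≤ homotopyRange n d := by
  refine symDeg_le_of_mon fun a L haL => ?_
  by_cases hL : L.Nodup
  · refine mem_homotopyRange (fun h => hd ?_) (homotopyOp_mon d a L)
    have h1 := length_le_of_nodup hL
    have h2 : n + d = 2 * L.length := by exact_mod_cast sub_eq_zero.1 h
    omega
  · rw [mon_eq_zero_of_not_nodup hL]; exact zero_mem _

/-- The monomial `ξ₁ ⋯ ξₙ`. -/
noncomputable def xiTop (n : ℕ) : SymAlg n := mon 0 (List.finRange n)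

theorem xiTop_ne_zero : xiTop n ≠ 0 := mon_ne_zero (List.nodup_finRange n) 0

theorem xiTop_mem : xiTop n ∈ symDeg n n := mon_mem (by simp)

theorem der_inl_xiTop (i : Fin n) : der n (.inl i) (xiTop n) = 0 := by
  simp [xiTop, der_inl_mon]

theorem contr_xiTop : contr n (xiTop n) = 0 := by
  simp [contr_apply, der_inl_comm, der_inl_xiTop]

theorem homotopyOp_xiTop : homotopyOp n n (xiTop n) = 0 := by
  rw [xiTop, homotopyOp_mon, List.length_finRange]
  simp [two_mul]

theorem symDeg_le_homotopyRange_sup :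
    symDeg n n ≤ homotopyRange n n ⊔ Submodule.span ℂ {xiTop n} := by
  refine symDeg_le_of_mon fun a L haL => ?_
  by_cases hL : L.Nodup
  · by_cases h : L.length = n
    · refine Submodule.mem_sup_right ?_
      obtain rfl : a = 0 := (Finsupp.degree_eq_zero_iff a).1 (by omega)
      refine mon_mem_span_of_perm ((List.perm_ext_iff_of_nodup hL (List.nodup_finRange n)).2
        fun i => ?_) 0
      have h1 : L.toFinset = univ := by
        rw [← Finset.card_eq_iff_eq_univ, List.toFinset_card_of_nodup hL, h, Fintype.card_fin]
      have := Finset.mem_univ i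
      rw [← h1, List.mem_toFinset] at this
      simpa using this
    · refine Submodule.mem_sup_left (mem_homotopyRange (fun h0 => h ?_) (homotopyOp_mon n a L))
      have h2 : n + n = 2 * L.length := by exact_mod_cast sub_eq_zero.1 h0
      omega
  · rw [mon_eq_zero_of_not_nodup hL]; exact zero_mem _

/-- Contracting a monomial with `k ≤ n` odd factors leaves `k - 1` of them, so the eigenvalue is `2n
+ 2 - 2k`, which is not zero. Hence `ξ₁ ⋯ ξₙ`, of eigenvalue zero, is not in the image. -/
theorem map_contr_le_homotopyRange :
    (symDeg n (n + 2)).map (contr n) ≤ homotopyRange n n := by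
  rw [Submodule.map_le_iff_le_comap]
  refine symDeg_le_of_mon fun a L _ => ?_
  rw [Submodule.mem_comap]
  by_cases hL : L.Nodup
  · have h1 := length_le_of_nodup hL
    refine mem_homotopyRange (μ := (n : ℂ) + n + 2 - 2 * L.length) (fun h0 => ?_) ?_
    · have h2 : n + n + 2 = 2 * L.length := by exact_mod_cast sub_eq_zero.1 h0
      omega
    · have h := contr_oddDegree (mon a L)
      rw [oddDegree_mon, map_smul] at h
      rw [homotopyOp_apply, ← sub_eq_iff_eq_add'.2 h]
      module
  · rw [mon_eq_zero_of_not_nodup hL, map_zero]; exact zero_mem _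

theorem xiTop_notMem : xiTop n ∉ (symDeg n (n + 2)).map (contr n) := fun h =>
  xiTop_ne_zero (eq_zero_of_mem_homotopyRange (map_contr_le_homotopyRange h) homotopyOp_xiTop)

theorem map_contr_le (d : ℕ) :
    (symDeg n (d + 2)).map (contr n) ≤ symDeg n d ⊓ LinearMap.ker (contr n) := by
  rintro _ ⟨g, hg, rfl⟩
  exact ⟨contr_mem (d + 2) hg, contr_contr g⟩

theorem ker_contr_eq_of_ne {d : ℕ} (hd : d ≠ n) :
    symDeg n d ⊓ LinearMap.ker (contr n) = (symDeg n (d + 2)).map (contr n) :=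
  le_antisymm (fun _ hf => mem_map_contr_of_homotopyRange hf.1 hf.2
    (symDeg_le_homotopyRange hd hf.1)) (map_contr_le d)

/-- Since `ξ₁ ⋯ ξₙ` itself lies in the kernel, it can be split off, and the homotopy argument
applies to the remaining component. -/
theorem ker_contr_le :
    symDeg n n ⊓ LinearMap.ker (contr n) ≤
      (symDeg n (n + 2)).map (contr n) ⊔ Submodule.span ℂ {xiTop n} := by
  rintro f ⟨hf, hq⟩
  obtain ⟨g, hg, x, hx, rfl⟩ := Submodule.mem_sup.1 (symDeg_le_homotopyRange_sup hf)
  obtain ⟨c, rfl⟩ := Submodule.mem_span_singleton.1 hx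
  refine Submodule.add_mem_sup (mem_map_contr_of_homotopyRange ?_ ?_ hg) hx
  · exact (Submodule.add_mem_iff_left _ (Submodule.smul_mem _ _ xiTop_mem)).1 hf
  · simpa [contr_xiTop] using hq

end Kernel

/-! ### Weights of the symmetric powers. -/

section Weights

variable {n : ℕ}

/-- The weight of a generator. -/
noncomputable def genWeight : Fin n ⊕ Fin n → Fin n → ℂ
  | .inl j => eps j
  | .inr j => -eps j

theorem opA_self_der (i : Fin n) (b : Fin n ⊕ Fin n) (f : SymAlg n) :
    opA i i (der n b f) = der n b (opA i i f) - genWeight b i • der n b f := by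
  rcases b with j | j
  · rw [opA_apply, opA_apply, map_sub, der_inl_inl, der_inl_inr, der_inl_comm j, der_inl_comm j]
    by_cases h : j = i
    · subst h; simp [genWeight, eps]; abel
    · simp [genWeight, eps, h, Ne.symm h]
  · rw [opA_apply, opA_apply, map_sub, der_inr_inl, der_inr_inr, der_inl_comm i,
      der_inr_anticomm j i]
    by_cases h : j = i
    · subst h; simp [genWeight, eps]; abel
    · simp [genWeight, eps, h, Ne.symm h]

theorem eps_zero_sub_genWeight_mem (hn : 0 < n) (b : Fin n ⊕ Fin n) :
    eps (⟨0, hn⟩ : Fin n) - genWeight b ∈ AddSubmonoid.closure (posRoots n) := by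
  rcases b with j | j
  · by_cases h : j = ⟨0, hn⟩
    · subst h; simp [genWeight]
    · refine AddSubmonoid.subset_closure ⟨⟨0, hn⟩, j, Or.inl ⟨?_, rfl⟩⟩
      exact Fin.lt_def.2 (Nat.pos_of_ne_zero fun h0 => h (Fin.ext h0))
  · refine AddSubmonoid.subset_closure ⟨⟨0, hn⟩, j, Or.inr ⟨Nat.zero_le _, ?_⟩⟩
    simp [genWeight]

/-- A nonzero `f` of positive degree has a nonzero derivative `∂_b f`, whose weight is that of `f`
minus the weight of `y_b`. By induction on the degree it remains to see that `ε₁` minus a weight of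
`V` is zero or a positive root. -/
theorem weight_mem_closure (hn : 0 < n) {d : ℕ} {f : SymAlg n} (hf : f ∈ symDeg n d) (h0 : f ≠ 0)
    {ν : Fin n → ℂ} (h : ∀ i, opA i i f = ν i • f) :
    (d : ℂ) • eps (⟨0, hn⟩ : Fin n) - ν ∈ AddSubmonoid.closure (posRoots n) := by
  induction d generalizing f ν with
  | zero =>
    have : ν = 0 := by
      ext i
      have h1 := h i
      rw [opA_apply, der_mem_zero _ hf, der_mem_zero _ hf] at h1
      simpa [h0] using h1.symm
    simp [this]
  | succ d ih =>
    obtain ⟨b, hb⟩ : ∃ b, der n b f ≠ 0 := by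
      by_contra! h1
      exact h0 (eq_zero_of_der_eq_zero d.succ_ne_zero hf h1)
    have h2 := ih (der_mem_succ b d hf) hb (ν := ν - genWeight b) fun i => by
      rw [opA_self_der, h, map_smul, Pi.sub_apply, sub_smul]
    have h3 := add_mem h2 (eps_zero_sub_genWeight_mem hn b)
    convert h3 using 1
    push_cast
    module

theorem opA_self_mon (i : Fin n) (a : Fin n →₀ ℕ) (L : List (Fin n)) :
    opA i i (mon a L) = ((a i : ℂ) - L.count i) • mon a L := by
  induction L with
  | nil =>
    rw [opA_apply, der_inr_mon_nil, mul_zero, sub_zero, der_inl_mon, mul_smul_comm,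
      gen_inl_mul_mon]
    by_cases h : a i = 0
    · simp [h]
    · rw [Finsupp.sub_add_single_one_cancel h]; simp
  | cons j L ih =>
    have h : opA i i (gen n (.inr j) * mon a L) =
        gen n (.inr j) * opA i i (mon a L) - (if j = i then gen n (.inr j) * mon a L else 0) := by
      simp only [opA_apply, der_inl_inr, der_inr_inr, mul_sub, gen_inl_comm]
      rw [gen_inr_anticomm i j]
      by_cases h : i = j
      · subst h; simp; abel
      · simp [h, Ne.symm h]
    rw [← gen_inr_mul_mon, h, ih, mul_smul_comm, List.count_cons]
    by_cases h : j = i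
    · subst h; simp; module
    · simp [h]

end Weights

/-! ### Isomorphisms, parity shift, simple subquotients and the socle series in general. -/

namespace SuperModule

variable {𝔤 : LieSuperalgebra}

theorem Isomorphic.refl (M : SuperModule 𝔤) : M.Isomorphic M :=
  ⟨LinearEquiv.refl ℂ _, fun _ _ hv => hv, fun _ _ => rfl⟩

theorem Isomorphic.trans {M N P : SuperModule 𝔤} (h : M.Isomorphic N) (h' : N.Isomorphic P) :
    M.Isomorphic P := by
  obtain ⟨e, h1, h2⟩ := h
  obtain ⟨e', h1', h2'⟩ := h'
  exact ⟨e.trans e', fun i v hv => h1' i _ (h1 i v hv), fun x v => by simp [h2, h2']⟩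

theorem eq_of_add_eq_add (M : SuperModule 𝔤) {a b c d : M.carrier} (ha : a ∈ M.gr 0)
    (hb : b ∈ M.gr 1) (hc : c ∈ M.gr 0) (hd : d ∈ M.gr 1) (h : a + b = c + d) :
    a = c ∧ b = d := by
  have hz : a - c ∈ M.gr 0 ⊓ M.gr 1 := by
    refine ⟨sub_mem ha hc, ?_⟩
    rw [sub_eq_sub_iff_add_eq_add.2 (show a + b = d + c by rw [h, add_comm])]
    exact sub_mem hd hb
  rw [M.isCompl.inf_eq_bot, Submodule.mem_bot, sub_eq_zero] at hz
  subst hz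
  exact ⟨rfl, add_left_cancel h⟩

theorem Isomorphic.symm {M N : SuperModule 𝔤} (h : M.Isomorphic N) : N.Isomorphic M := by
  obtain ⟨e, h1, h2⟩ := h
  refine ⟨e.symm, fun i v hv => ?_, fun x v => ?_⟩
  · obtain ⟨a, ha, b, hb, hab⟩ := M.exists_add (e.symm v)
    have hv' : v = e a + e b := by rw [← map_add, ← hab, e.apply_symm_apply]
    rw [hab]
    have hi : ∀ p : ZMod 2, p = 0 ∨ p = 1 := by decide
    rcases hi i with rfl | rfl
    · have := N.eq_of_add_eq_add hv (zero_mem _) (h1 0 a ha) (h1 1 b hb) (by rw [add_zero, hv'])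
      rw [(map_eq_zero_iff e e.injective).1 this.2.symm, add_zero]
      exact ha
    · have := N.eq_of_add_eq_add (zero_mem _) hv (h1 0 a ha) (h1 1 b hb) (by rw [zero_add, hv'])
      rw [(map_eq_zero_iff e e.injective).1 this.1.symm, zero_add]
      exact hb
  · rw [e.symm_apply_eq, h2, e.apply_symm_apply]

theorem parityInv_parityInv (M : SuperModule 𝔤) (v : M.carrier) :
    M.parityInv (M.parityInv v) = v :=
  LinearMap.congr_fun M.parityInv_sq v

theorem parityShift_ρ_apply (M : SuperModule 𝔤) (x : 𝔤.carrier) (v : M.carrier) :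
    M.parityShift.ρ x v = M.parityInv (M.ρ x (M.parityInv v)) := rfl

theorem parityInv_parityShift (M : SuperModule 𝔤) (v : M.carrier) :
    M.parityShift.parityInv v = -M.parityInv v := by
  obtain ⟨a, ha, b, hb, rfl⟩ := M.exists_add v
  have hb' : b ∈ M.parityShift.gr 0 := by
    change b ∈ M.gr (0 + 1); rwa [zero_add]
  have ha' : a ∈ M.parityShift.gr 1 := by
    change a ∈ M.gr (1 + 1); rwa [show (1 + 1 : ZMod 2) = 0 by decide]
  have h1 : M.parityShift.parityInv (a + b) = -a + b := by
    exact (map_add M.parityShift.parityInv a b).trans (congrArg₂ (fun u v : M.carrier => u + v)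
      (M.parityShift.parityInv_one ha') (M.parityShift.parityInv_zero hb'))
  rw [h1, map_add, M.parityInv_zero ha, M.parityInv_one hb]
  abel

/-- The identity map works: the two parity involutions by which the action gets conjugated differ by
a sign, so together they conjugate by a scalar. -/
theorem isomorphic_parityShift_parityShift (M : SuperModule 𝔤) :
    M.Isomorphic M.parityShift.parityShift := by
  refine ⟨LinearEquiv.refl ℂ _, fun i v hv => ?_, fun x v => ?_⟩
  · change v ∈ M.gr (i + 1 + 1)
    rwa [add_assoc, show (1 + 1 : ZMod 2) = 0 by decide, add_zero]
  · have h1 : M.parityShift.ρ x (M.parityShift.parityInv v) =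
        M.parityInv (M.ρ x (M.parityInv (-M.parityInv v))) :=
      congrArg (fun w => M.parityInv (M.ρ x (M.parityInv w))) (parityInv_parityShift M v)
    refine Eq.trans ?_ ((congrArg M.parityShift.parityInv h1).trans
      (parityInv_parityShift M _)).symm
    simp only [parityInv_parityInv, map_neg, neg_neg]
    rfl

theorem isomorphic_iterate_parityShift (M : SuperModule 𝔤) (k : ℕ) :
    M.Isomorphic (parityShift^[k] (parityShift^[k] M)) := by
  induction k with
  | zero => exact Isomorphic.refl M
  | succ k ih =>
    refine ih.trans ?_
    have : parityShift^[k + 1] (parityShift^[k + 1] M) =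
        (parityShift^[k] (parityShift^[k] M)).parityShift.parityShift := by
      rw [Function.iterate_succ_apply', Function.iterate_succ_apply', ← Function.iterate_succ_apply,
        Function.iterate_succ_apply']
    rw [this]
    exact isomorphic_parityShift_parityShift _

theorem map_parityInv_mem {M : SuperModule 𝔤} (N : Sub M) {v : M.carrier} (hv : v ∈ N.carrier) :
    M.parityInv v ∈ N.carrier := by
  obtain ⟨a, ha, b, hb, rfl⟩ := M.exists_add v
  obtain ⟨h1, h2⟩ := N.graded a ha b hb hv
  rw [map_add, M.parityInv_zero ha, M.parityInv_one hb]
  exact add_mem h1 (neg_mem h2)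

/-- Graded subspaces are stable under the parity involution, so conjugating the action by it does
not change which of them are submodules. -/
theorem isSimple_parityShift {M : SuperModule 𝔤} (h : M.IsSimple) : M.parityShift.IsSimple := by
  let f : Sub M.parityShift → Sub M := fun N =>
    { carrier := N.carrier
      graded := by
        intro a ha b hb hab
        have hb' : b ∈ M.parityShift.gr 0 := by
          change b ∈ M.gr (0 + 1); rwa [zero_add]
        have ha' : a ∈ M.parityShift.gr 1 := by
          change a ∈ M.gr (1 + 1); rwa [show (1 + 1 : ZMod 2) = 0 by decide]
        exact (N.graded b hb' a ha' (Eq.subst (motive := (· ∈ N.carrier)) (add_comm a b) hab)).symm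
      invariant := by
        intro x v hv
        have hP : ∀ w : M.carrier, w ∈ N.carrier → M.parityInv w ∈ N.carrier := fun w hw =>
          neg_mem_iff.1 (Eq.subst (motive := (· ∈ N.carrier)) (parityInv_parityShift M w)
            (map_parityInv_mem N hw))
        have h2 := hP _ (N.invariant x _ (hP v hv))
        have h3 : M.parityInv (M.parityShift.ρ x (M.parityInv v)) = M.ρ x v := by
          rw [parityShift_ρ_apply, parityInv_parityInv, parityInv_parityInv]
        exact Eq.subst (motive := (· ∈ N.carrier)) h3 h2 }
  have hf : Function.Injective f := fun N N' h => Sub.ext (congrArg (Sub.carrier (M := M)) h)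
  have hs := h
  refine @IsSimpleOrder.mk _ _ _ ⟨⊥, ⊤, fun h0 => ?_⟩ fun N => ?_
  · exact hs.bot_ne_top (Sub.ext (congrArg (Sub.carrier (M := M.parityShift)) h0) : (⊥ : Sub M) = ⊤)
  · rcases hs.eq_bot_or_eq_top (f N) with h | h
    · exact Or.inl (hf h)
    · exact Or.inr (hf h)

/-- The subquotient `N / K` is simple if `N` covers `K`. -/
theorem isSimple_subquotient {M : SuperModule 𝔤} {K N : Sub M} (h : K ⋖ N) :
    (Sub.subquotient K N).IsSimple := by
  let q := (K.carrier.comap N.carrier.subtype).mkQ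
  have hKN : K.carrier ≤ N.carrier := h.le
  let f : Sub (Sub.subquotient K N) → Sub M := fun U =>
    { carrier := (U.carrier.comap q).map N.carrier.subtype
      graded := by
        rintro a ha b hb ⟨v, hv, hvab⟩
        have hab : a + b ∈ N.carrier := by rw [← hvab]; exact v.2
        obtain ⟨h1, h2⟩ := N.graded a ha b hb hab
        have := U.graded (q ⟨a, h1⟩) ⟨⟨a, h1⟩, ha, rfl⟩ (q ⟨b, h2⟩) ⟨⟨b, h2⟩, hb, rfl⟩ (by
          have : v = ⟨a, h1⟩ + ⟨b, h2⟩ := Subtype.ext hvab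
          rw [this] at hv
          exact hv)
        exact ⟨⟨_, this.1, rfl⟩, ⟨_, this.2, rfl⟩⟩
      invariant := by
        rintro x _ ⟨v, hv, rfl⟩
        exact ⟨⟨_, N.invariant x v.1 v.2⟩, U.invariant x _ hv, rfl⟩ }
  have hfK : ∀ U, K ≤ f U := fun U v hv =>
    ⟨⟨v, hKN hv⟩, by
      have : q ⟨v, hKN hv⟩ = 0 := (Submodule.Quotient.mk_eq_zero _).2 hv
      change q ⟨v, hKN hv⟩ ∈ U.carrier
      rw [this]; exact zero_mem _, rfl⟩
  have hfN : ∀ U, f U ≤ N := fun U => by rintro _ ⟨v, -, rfl⟩; exact v.2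
  refine @IsSimpleOrder.mk _ _ _ ⟨⊥, ⊤, fun h0 => ?_⟩ fun U => ?_
  · refine h.lt.not_ge fun v hv => ?_
    have h1 : q ⟨v, hv⟩ ∈ (⊥ : Sub (Sub.subquotient K N)).carrier := by rw [h0]; trivial
    have h2 : q ⟨v, hv⟩ = 0 := h1
    exact (Submodule.Quotient.mk_eq_zero (K.carrier.comap N.carrier.subtype)).1 h2
  · rcases h.eq_or_eq (hfK U) (hfN U) with hU | hU
    · refine Or.inl (Sub.ext (eq_bot_iff.2 fun v hv => ?_))
      obtain ⟨w, rfl⟩ := Submodule.mkQ_surjective _ v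
      have : w.1 ∈ (f U).carrier := ⟨w, hv, rfl⟩
      rw [hU] at this
      exact (Submodule.mem_bot _).2 ((Submodule.Quotient.mk_eq_zero _).2 this)
    · refine Or.inr (Sub.ext (eq_top_iff.2 fun v _ => ?_))
      obtain ⟨w, rfl⟩ := Submodule.mkQ_surjective _ v
      have : w.1 ∈ (f U).carrier := by rw [hU]; exact w.2
      obtain ⟨w', hw', h⟩ := this
      obtain rfl : w' = w := Subtype.ext h
      exact hw'

/-- With a single cover of the current term, the socle of the quotient is simple and the next term
is that cover. -/
theorem socleSeries_succ_of_covBy {M : SuperModule 𝔤} {k : ℕ} {S N : Sub M}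
    (h : M.socleSeries k = S) (hN : S ⋖ N) (huniq : ∀ N', S ⋖ N' → N' = N) :
    M.socleSeries (k + 1) = N := by
  have : {N' | S ⋖ N'} = {N} := Set.ext fun N' => ⟨huniq N', fun h => by rwa [h]⟩
  rw [socleSeries, h, this, sSup_singleton, sup_eq_right.2 hN.le]

end SuperModule

/-! ### Recognising parity shifts of highest weight modules. -/

section HighestWeight

variable {n : ℕ}

theorem cartan_mem_gr (t : Fin n → ℂ) : cartan n t ∈ (periplectic n).gr 0 := by
  intro a b h
  change Matrix.diagonal _ a b = 0
  refine Matrix.diagonal_apply_ne _ fun hab => h ?_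
  subst hab
  generalize par a = p
  revert p; decide

/-- `M` is isomorphic to `Π^k L(μ)`, spelled out in terms of `M`. -/
structure IsShiftedL (k : ℕ) (μ : Fin n → ℂ) (M : SuperModule (periplectic n)) : Prop where
  finite : FiniteDimensional ℂ M.carrier
  simple : M.IsSimple
  vector : ∃ v ∈ weightSpace M μ, v ∈ M.gr k ∧ v ≠ 0
  highest : ∀ ν : Fin n → ℂ, weightSpace M ν ≠ ⊥ → μ - ν ∈ AddSubmonoid.closure (posRoots n)

/-- Cartan elements are even, so their action commutes with the parity involution. -/
theorem weightSpace_parityShift (M : SuperModule (periplectic n)) (ν : Fin n → ℂ) :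
    weightSpace M.parityShift ν = weightSpace M ν := by
  have key : ∀ t v, M.parityShift.ρ (cartan n t) v = M.ρ (cartan n t) v := by
    intro t v
    obtain ⟨a, ha, b, hb, rfl⟩ := M.exists_add v
    have ha' := M.ρ_mem 0 0 _ (cartan_mem_gr t) a ha
    have hb' := M.ρ_mem 0 1 _ (cartan_mem_gr t) b hb
    rw [zero_add] at ha' hb'
    rw [SuperModule.parityShift_ρ_apply, map_add, M.parityInv_zero ha, M.parityInv_one hb, map_add,
      map_add, map_neg, M.parityInv_zero ha', map_neg, M.parityInv_one hb', map_add, neg_neg]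
  ext v
  exact ⟨fun h t => (key t v).symm.trans (h t), fun h t => (key t v).trans (h t)⟩

theorem IsShiftedL.parityShift {k : ℕ} {μ : Fin n → ℂ} {M : SuperModule (periplectic n)}
    (h : IsShiftedL (k + 1) μ M) : IsShiftedL k μ M.parityShift where
  finite := h.finite
  simple := SuperModule.isSimple_parityShift h.simple
  vector := by
    obtain ⟨v, hv, hk, h0⟩ := h.vector
    refine ⟨v, by rw [weightSpace_parityShift]; exact hv, ?_, h0⟩
    rw [Nat.cast_add, Nat.cast_one] at hk
    exact hk
  highest ν := by rw [weightSpace_parityShift]; exact h.highest ν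

theorem IsShiftedL.isL_iterate {k : ℕ} {μ : Fin n → ℂ} {M : SuperModule (periplectic n)}
    (h : IsShiftedL k μ M) : IsL μ (SuperModule.parityShift^[k] M) := by
  induction k generalizing M with
  | zero => exact ⟨h.finite, h.simple, by have := h.vector; rw [Nat.cast_zero] at this; exact this, h.highest⟩
  | succ k ih => rw [Function.iterate_succ_apply]; exact ih h.parityShift

/-- The witness is `Π^k M` itself, since `Π^k Π^k M ≅ M`. -/
theorem IsShiftedL.isoShiftL {k : ℕ} {μ : Fin n → ℂ} {M : SuperModule (periplectic n)}
    (h : IsShiftedL k μ M) : IsoShiftL k μ M :=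
  ⟨_, h.isL_iterate, M.isomorphic_iterate_parityShift k⟩

end HighestWeight

/-! ### From matrices in 𝔭(n) to the operators `opA`, `opB`, `opC`. -/

section Periplectic

variable {n : ℕ}

theorem matAct_single (a b : Fin n ⊕ Fin n) : matAct n (Matrix.single a b 1) = elemOp a b := by
  rw [matAct_eq, sum_eq_single a, sum_eq_single b]
  · simp
  · intro c _ hc; simp [Ne.symm hc]
  · simp
  · intro c _ hc; simp [Ne.symm hc]
  · simp

theorem exists_matAct_eq_opA (i j : Fin n) :
    ∃ X ∈ periplecticSubmodule n, matAct n X = opA i j := by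
  refine ⟨Matrix.single (.inl i) (.inl j) 1 - Matrix.single (.inr j) (.inr i) 1,
    ⟨fun k l => ?_, fun k l => ?_, fun k l => ?_⟩, by rw [map_sub, matAct_single, matAct_single]; rfl⟩
  · simp [Matrix.single_apply, and_comm]
  · simp
  · simp

theorem exists_matAct_eq_opB (i j : Fin n) :
    ∃ X ∈ periplecticSubmodule n, matAct n X = opB i j := by
  refine ⟨Matrix.single (.inl i) (.inr j) 1 + Matrix.single (.inl j) (.inr i) 1,
    ⟨fun k l => ?_, fun k l => ?_, fun k l => ?_⟩, by rw [map_add, matAct_single, matAct_single]; rfl⟩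
  · simp
  · simp [Matrix.single_apply, and_comm, add_comm]
  · simp

theorem exists_matAct_eq_opC (i j : Fin n) :
    ∃ X ∈ periplecticSubmodule n, matAct n X = opC i j := by
  refine ⟨Matrix.single (.inr i) (.inl j) 1 - Matrix.single (.inr j) (.inl i) 1,
    ⟨fun k l => ?_, fun k l => ?_, fun k l => ?_⟩, by rw [map_sub, matAct_single, matAct_single]; rfl⟩
  · simp
  · simp
  · simp [Matrix.single_apply, and_comm]

/-- The factors one half appear because the sum runs over all ordered pairs, while `opB` is
symmetric and `opC` is antisymmetric in its indices. -/
theorem matAct_eq_sum_op {X : Mat n} (hX : X ∈ periplecticSubmodule n) :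
    matAct n X = ∑ i, ∑ j, (X (.inl i) (.inl j) • opA i j +
      (2⁻¹ * X (.inl i) (.inr j)) • opB i j + (2⁻¹ * X (.inr i) (.inl j)) • opC i j) := by
  obtain ⟨h1, h2, h3⟩ := hX
  rw [matAct_eq]
  simp only [Fintype.sum_sum_type, opA, opB, opC, smul_add, smul_sub, sum_add_distrib,
    sum_sub_distrib]
  rw [sum_comm (f := fun i j => X (.inl i) (.inl j) • elemOp (.inr j) (.inr i)),
    sum_comm (f := fun i j => (2⁻¹ * X (.inl i) (.inr j)) • elemOp (.inl j) (.inr i)),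
    sum_comm (f := fun i j => (2⁻¹ * X (.inr i) (.inl j)) • elemOp (.inr j) (.inl i))]
  simp only [← sum_add_distrib, ← sum_sub_distrib]
  refine sum_congr rfl fun i _ => sum_congr rfl fun j _ => ?_
  rw [h1 i j, h2 j i, h3 j i]
  module

theorem Invariant.matAct_mem {U : Submodule ℂ (SymAlg n)} (hU : Invariant U) {X : Mat n}
    (hX : X ∈ periplecticSubmodule n) {f : SymAlg n} (hf : f ∈ U) : matAct n X f ∈ U := by
  rw [matAct_eq_sum_op hX]
  simp only [LinearMap.sum_apply, LinearMap.add_apply, LinearMap.smul_apply]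
  exact sum_mem fun i _ => sum_mem fun j _ => add_mem (add_mem
    (Submodule.smul_mem _ _ (hU.opA i j f hf)) (Submodule.smul_mem _ _ (hU.opB i j f hf)))
    (Submodule.smul_mem _ _ (hU.opC i j f hf))

theorem invariant_of_matAct {U : Submodule ℂ (SymAlg n)}
    (h : ∀ X ∈ periplecticSubmodule n, ∀ f ∈ U, matAct n X f ∈ U) : Invariant U where
  opA i j f hf := by
    obtain ⟨X, hX, hXe⟩ := exists_matAct_eq_opA i j
    rw [← hXe]; exact h X hX f hf
  opB i j f hf := by
    obtain ⟨X, hX, hXe⟩ := exists_matAct_eq_opB i j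
    rw [← hXe]; exact h X hX f hf
  opC i j f hf := by
    obtain ⟨X, hX, hXe⟩ := exists_matAct_eq_opC i j
    rw [← hXe]; exact h X hX f hf

theorem invariant_symDeg (d : ℕ) : Invariant (symDeg n d) :=
  invariant_of_matAct fun X _ _ hf => SuperLie.matAct_mem X d hf

theorem Invariant.map_contr {U : Submodule ℂ (SymAlg n)} (hU : Invariant U) :
    Invariant (U.map (contr n)) where
  opA := by
    rintro i j _ ⟨f, hf, rfl⟩
    exact ⟨_, hU.opA i j f hf, contr_opA i j f⟩
  opB := by
    rintro i j _ ⟨f, hf, rfl⟩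
    exact ⟨_, neg_mem (hU.opB i j f hf), by rw [map_neg, contr_opB, neg_neg]⟩
  opC := by
    rintro i j _ ⟨f, hf, rfl⟩
    exact ⟨_, neg_mem (hU.opC i j f hf), by rw [map_neg, contr_opC, neg_neg]⟩

theorem Invariant.inf_ker_contr {U : Submodule ℂ (SymAlg n)} (hU : Invariant U) :
    Invariant (U ⊓ LinearMap.ker (contr n)) where
  opA i j f hf := ⟨hU.opA i j f hf.1, LinearMap.mem_ker.2 (by
    rw [contr_opA, LinearMap.mem_ker.1 hf.2, map_zero])⟩
  opB i j f hf := ⟨hU.opB i j f hf.1, LinearMap.mem_ker.2 (by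
    rw [contr_opB, LinearMap.mem_ker.1 hf.2, map_zero, neg_zero])⟩
  opC i j f hf := ⟨hU.opC i j f hf.1, LinearMap.mem_ker.2 (by
    rw [contr_opC, LinearMap.mem_ker.1 hf.2, map_zero, neg_zero])⟩

theorem matAct_cartan (t : Fin n → ℂ) (f : SymAlg n) :
    matAct n (cartan n t).1 f = ∑ i, t i • opA i i f := by
  rw [matAct_eq_sum_op (cartan n t).2, LinearMap.sum_apply]
  refine sum_congr rfl fun i _ => ?_
  rw [LinearMap.sum_apply, sum_eq_single i]
  · simp [cartan]
  · intro j _ hj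
    simp [cartan, hj.symm]
  · simp

end Periplectic

/-! ### Submodules of the symmetric powers as invariant subspaces of the symmetric algebra. -/

section SymPower

variable {n : ℕ}

/-- The subspace of `S(V)` underlying a submodule of `S^d V`. -/
noncomputable def subspace {d : ℕ} (N : SuperModule.Sub (symPower n d)) : Submodule ℂ (SymAlg n) :=
  N.carrier.map (symDeg n d).subtype

theorem mem_subspace {d : ℕ} {N : SuperModule.Sub (symPower n d)} {f : SymAlg n}
    (hf : f ∈ symDeg n d) : f ∈ subspace N ↔ (⟨f, hf⟩ : symDeg n d) ∈ N.carrier := by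
  constructor
  · rintro ⟨g, hg, rfl⟩; exact hg
  · intro h; exact ⟨_, h, rfl⟩

theorem subspace_le {d : ℕ} (N : SuperModule.Sub (symPower n d)) : subspace N ≤ symDeg n d := by
  rintro _ ⟨g, -, rfl⟩; exact g.2

theorem subspace_le_subspace {d : ℕ} {N N' : SuperModule.Sub (symPower n d)} :
    subspace N ≤ subspace N' ↔ N ≤ N' :=
  Submodule.map_le_map_iff_of_injective (Submodule.injective_subtype _) _ _

theorem subspace_injective {d : ℕ} :
    Function.Injective (subspace : SuperModule.Sub (symPower n d) → _) := fun _ _ h =>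
  le_antisymm (subspace_le_subspace.1 h.le) (subspace_le_subspace.1 h.ge)

theorem invariant_subspace {d : ℕ} (N : SuperModule.Sub (symPower n d)) :
    Invariant (subspace N) := by
  refine invariant_of_matAct ?_
  rintro X hX _ ⟨f, hf, rfl⟩
  exact ⟨_, N.invariant ⟨X, hX⟩ f hf, rfl⟩

theorem subspace_bot {d : ℕ} : subspace (⊥ : SuperModule.Sub (symPower n d)) = ⊥ :=
  Submodule.map_bot _

theorem subspace_top {d : ℕ} : subspace (⊤ : SuperModule.Sub (symPower n d)) = symDeg n d :=
  (Submodule.map_top _).trans (Submodule.range_subtype _)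

/-- The submodule of `S^d V` with a given invariant underlying subspace. -/
noncomputable def subOfSubspace (d : ℕ) (U : Submodule ℂ (SymAlg n)) (hU : Invariant U)
    (hinv : ∀ f ∈ U, invol n f ∈ U) : SuperModule.Sub (symPower n d) where
  carrier := U.comap (symDeg n d).subtype
  graded := by
    rintro ⟨a, ha⟩ h0 ⟨b, hb⟩ h1 hab
    have h0' : invol n a - koszul 0 1 • a = 0 := h0
    have h1' : invol n b - koszul 1 1 • b = 0 := h1
    have hab' : a + b ∈ U := hab
    rw [sub_eq_zero] at h0' h1'
    have h2 := hinv _ hab'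
    rw [map_add, h0', h1'] at h2
    simp only [koszul, zero_ne_one, false_and, if_false, and_self, if_true, one_smul,
      neg_smul] at h2
    -- Here `h2` says `a - b ∈ U`, so adding `a + b ∈ U` gives `2a ∈ U`.
    have h3 := add_mem hab' h2
    have h4 : (2 : ℂ) • a ∈ U := by
      convert h3 using 1
      module
    have h5 : a ∈ U := (Submodule.smul_mem_iff _ two_ne_zero).1 h4
    exact ⟨h5, (Submodule.add_mem_iff_right _ h5).1 hab'⟩
  invariant := by
    rintro ⟨X, hX⟩ ⟨f, hf⟩ hfU
    exact hU.matAct_mem hX hfU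

theorem subspace_subOfSubspace {d : ℕ} {U : Submodule ℂ (SymAlg n)} (hU : Invariant U)
    (hinv : ∀ f ∈ U, invol n f ∈ U) (hd : U ≤ symDeg n d) :
    subspace (subOfSubspace d U hU hinv) = U :=
  (Submodule.map_comap_subtype _ _).trans (inf_eq_right.2 hd)

/-- The kernel of the contraction, as a submodule of `S^d V`. -/
noncomputable def kerSub (n d : ℕ) : SuperModule.Sub (symPower n d) :=
  subOfSubspace d _ (invariant_symDeg d).inf_ker_contr fun f hf =>
    ⟨invol_mem d hf.1, LinearMap.mem_ker.2 (by
      rw [contr_invol, LinearMap.mem_ker.1 hf.2, map_zero, neg_zero])⟩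

/-- The image of the contraction, as a submodule of `S^d V`. -/
noncomputable def imSub (n d : ℕ) : SuperModule.Sub (symPower n d) :=
  subOfSubspace d _ (invariant_symDeg (d + 2)).map_contr (by
    rintro _ ⟨f, hf, rfl⟩
    exact ⟨_, neg_mem (invol_mem (d + 2) hf), by rw [map_neg, contr_invol, neg_neg]⟩)

theorem subspace_kerSub (d : ℕ) :
    subspace (kerSub n d) = symDeg n d ⊓ LinearMap.ker (contr n) :=
  subspace_subOfSubspace _ _ inf_le_left

theorem subspace_imSub (d : ℕ) :
    subspace (imSub n d) = (symDeg n (d + 2)).map (contr n) :=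
  subspace_subOfSubspace _ _ ((map_contr_le d).trans inf_le_left)

theorem kerSub_carrier (d : ℕ) : (kerSub n d).carrier = LinearMap.ker (oddContraction n d) := by
  ext ⟨f, hf⟩
  refine (mem_subspace hf).symm.trans ?_
  rw [subspace_kerSub]
  constructor
  · rintro ⟨-, h⟩; exact Subtype.ext h
  · intro h; exact ⟨hf, congrArg Subtype.val h⟩

theorem imSub_le_kerSub (d : ℕ) : imSub n d ≤ kerSub n d := by
  rw [← subspace_le_subspace, subspace_imSub, subspace_kerSub]; exact map_contr_le d

theorem imSub_eq_kerSub {d : ℕ} (hd : d ≠ n) : imSub n d = kerSub n d :=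
  subspace_injective (by rw [subspace_imSub, subspace_kerSub, ker_contr_eq_of_ne hd])

/-! ### The unique minimal and the unique maximal submodule. -/

theorem imSub_le (hn : 1 ≤ n) {d : ℕ} {N : SuperModule.Sub (symPower n d)} (hN : N ≠ ⊥) :
    imSub n d ≤ N := by
  rw [← subspace_le_subspace, subspace_imSub]
  refine contr_mem_of_invariant (invariant_subspace N) (subspace_le N) (fun h => hN ?_) hn
  exact subspace_injective (h.trans subspace_bot.symm)

theorem contr_mon_single (z : Fin n) (d : ℕ) :
    contr n (mon (Finsupp.single z (d + 1)) [z]) =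
      ((d : ℂ) + 1) • mon (Finsupp.single z d) [] := by
  rw [← gen_inr_mul_mon, contr_inr, contr_apply, der_inl_mon]
  simp [der_inr_mon_nil, Finsupp.single_add]

/-- Up to a nonzero scalar, `x_z^d` is the contraction of `x_z^{d+1} ξ_z`. This shows that the image
is nonzero and later supplies its highest weight vector. -/
theorem mon_single_mem_map_contr (z : Fin n) (d : ℕ) :
    mon (Finsupp.single z d) [] ∈ (symDeg n (d + 2)).map (contr n) := by
  refine (Submodule.smul_mem_iff _ (Nat.cast_add_one_ne_zero (R := ℂ) d)).1 ?_
  rw [← contr_mon_single]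
  exact Submodule.mem_map_of_mem (mon_mem (by simp))

theorem imSub_ne_bot (hn : 1 ≤ n) (d : ℕ) : imSub n d ≠ ⊥ := by
  intro h
  have h1 := mon_single_mem_map_contr (⟨0, hn⟩ : Fin n) d
  rw [← subspace_imSub, h, subspace_bot] at h1
  exact mon_nil_ne_zero _ ((Submodule.mem_bot ℂ).1 h1)

theorem bot_covBy_imSub (hn : 1 ≤ n) (d : ℕ) : ⊥ ⋖ imSub n d := by
  refine ⟨bot_lt_iff_ne_bot.2 (imSub_ne_bot hn d), fun N h1 h2 => ?_⟩
  exact h2.not_ge (imSub_le hn h1.ne')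

theorem eq_imSub_of_bot_covBy (hn : 1 ≤ n) {d : ℕ} {N : SuperModule.Sub (symPower n d)}
    (h : ⊥ ⋖ N) : N = imSub n d := by
  rcases h.eq_or_eq bot_le (imSub_le hn h.ne') with h1 | h1
  · exact absurd h1 (imSub_ne_bot hn d)
  · exact h1.symm

/-- The image `q(N)` is a nonzero invariant subspace in degree `d`, so by minimality it already
contains `q(S^{d+2} V)`; thus `N + ker q` is everything. -/
theorem exists_sub_mem_kerSub (hn : 1 ≤ n) {d : ℕ} {N : SuperModule.Sub (symPower n (d + 2))}
    (hN : ¬ N ≤ kerSub n (d + 2)) {f : SymAlg n} (hf : f ∈ symDeg n (d + 2)) :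
    ∃ g ∈ subspace N, f - g ∈ subspace (kerSub n (d + 2)) := by
  have h : (subspace N).map (contr n) ≠ ⊥ := by
    intro h0
    refine hN ?_
    rw [← subspace_le_subspace, subspace_kerSub]
    exact le_inf (subspace_le N) (LinearMap.le_ker_iff_map.2 h0)
  have h1 : (subspace N).map (contr n) ≤ symDeg n d := by
    rintro _ ⟨g, hg, rfl⟩; exact contr_mem (d + 2) (subspace_le N hg)
  obtain ⟨g, hg, hgf⟩ := contr_mem_of_invariant (invariant_subspace N).map_contr h1 h hn
    ⟨f, hf, rfl⟩
  refine ⟨g, hg, ?_⟩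
  rw [subspace_kerSub]
  exact ⟨sub_mem hf (subspace_le N hg), LinearMap.mem_ker.2 (by rw [map_sub, hgf, sub_self])⟩

/-- When kernel and image agree this is minimality of the image. In degree `n` the only missing
vector is `ξ₁ ⋯ ξₙ`, which is obtained by applying an operator `opC` to a monomial known modulo `N +
ker q`. -/
theorem kerSub_le_of_not_le (hn : 1 ≤ n) {d : ℕ} {N : SuperModule.Sub (symPower n (d + 2))}
    (hN : ¬ N ≤ kerSub n (d + 2)) : kerSub n (d + 2) ≤ N := by
  have hN0 : N ≠ ⊥ := by rintro rfl; exact hN bot_le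
  by_cases hd : d + 2 = n
  · subst hd
    have hW : subspace (imSub (d + 2) (d + 2)) ≤ subspace N :=
      subspace_le_subspace.2 (imSub_le hn hN0)
    rw [← subspace_le_subspace, subspace_kerSub]
    refine ker_contr_le.trans (sup_le (by rwa [← subspace_imSub]) ?_)
    rw [Submodule.span_singleton_le_iff_mem]
    let i : Fin (d + 2) := 0
    let j : Fin (d + 2) := 1
    have hL : List.finRange (d + 2) = i :: j :: (List.finRange (d + 2)).tail.tail := by
      simp [List.finRange_succ, i, j]
    -- With indices from zero, `ξ₀ ξ₁ ⋯` arises from `x₁ ξ₁ ξ₂ ⋯` by replacing `x₁` with `ξ₀`; two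
    -- distinct indices exist because `n = d + 2`.
    have hC : opC i j (mon (Finsupp.single j 1) (j :: (List.finRange (d + 2)).tail.tail)) =
        xiTop (d + 2) := by
      have := opC_mon i j 0 (List.finRange (d + 2)).tail.tail
      rw [zero_add, ← hL] at this
      simpa [xiTop] using this
    have hmem : mon (Finsupp.single j 1) (j :: (List.finRange (d + 2)).tail.tail) ∈
        symDeg (d + 2) (d + 2) := mon_mem (by simp; omega)
    obtain ⟨g, hg, hgk⟩ := exists_sub_mem_kerSub hn hN hmem
    rw [subspace_kerSub] at hgk
    obtain ⟨w, hw, x, hx, hwx⟩ := Submodule.mem_sup.1 (ker_contr_le hgk)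
    obtain ⟨c, rfl⟩ := Submodule.mem_span_singleton.1 hx
    -- The unknown multiple of `ξ₁ ⋯ ξₙ` in the decomposition disappears under `opC`, as there is no
    -- even variable to differentiate. What remains expresses `ξ₁ ⋯ ξₙ` through vectors of `N`.
    have hCx : opC i j (xiTop (d + 2)) = 0 := by
      rw [opC_apply, der_inl_xiTop, der_inl_xiTop, mul_zero, mul_zero, sub_zero]
    have h2 := congrArg (opC i j) hwx
    rw [map_add, map_smul, hCx, smul_zero, add_zero, map_sub, hC, eq_sub_iff_add_eq] at h2
    rw [← h2]
    rw [← subspace_imSub] at hw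
    exact add_mem ((invariant_subspace N).opC i j w (hW hw)) ((invariant_subspace N).opC i j g hg)
  · rw [← imSub_eq_kerSub hd]
    exact imSub_le hn hN0

theorem eq_top_of_not_le (hn : 1 ≤ n) {d : ℕ} {N : SuperModule.Sub (symPower n (d + 2))}
    (hN : ¬ N ≤ kerSub n (d + 2)) : N = ⊤ := by
  refine subspace_injective (le_antisymm ?_ ?_)
  · rw [subspace_top]; exact subspace_le N
  · rw [subspace_top]
    intro f hf
    obtain ⟨g, hg, h⟩ := exists_sub_mem_kerSub hn hN hf
    have := add_mem (subspace_le_subspace.2 (kerSub_le_of_not_le hn hN) h) hg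
    rwa [sub_add_cancel] at this

theorem kerSub_ne_top (hn : 1 ≤ n) (d : ℕ) : kerSub n (d + 2) ≠ ⊤ := by
  intro h
  have h1 : mon (Finsupp.single (⟨0, hn⟩ : Fin n) (d + 1)) [⟨0, hn⟩] ∈ symDeg n (d + 2) :=
    mon_mem (by simp)
  rw [← subspace_top, ← h, subspace_kerSub] at h1
  have h2 := LinearMap.mem_ker.1 h1.2
  rw [contr_mon_single] at h2
  exact (smul_eq_zero.1 h2).elim (Nat.cast_add_one_ne_zero d) (mon_nil_ne_zero _)

theorem kerSub_covBy_top (hn : 1 ≤ n) (d : ℕ) : kerSub n (d + 2) ⋖ ⊤ :=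
  ⟨lt_top_iff_ne_top.2 (kerSub_ne_top hn d), fun _ h1 h2 =>
    h2.ne (eq_top_of_not_le hn h1.not_ge)⟩

theorem eq_top_of_kerSub_covBy (hn : 1 ≤ n) {d : ℕ} {N : SuperModule.Sub (symPower n (d + 2))}
    (h : kerSub n (d + 2) ⋖ N) : N = ⊤ :=
  eq_top_of_not_le hn h.lt.not_ge

/-- A submodule not contained in `ker q` is everything, so every proper submodule lies in `ker q`
and this is the only maximal one. -/
theorem radical_eq (hn : 1 ≤ n) (d : ℕ) : (symPower n (d + 2)).radical = kerSub n (d + 2) := by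
  have : {N : SuperModule.Sub (symPower n (d + 2)) | IsCoatom N} = {kerSub n (d + 2)} := by
    refine Set.ext fun N => ⟨fun h => ?_, fun h => ?_⟩
    · by_contra hne
      have h1 : N ≤ kerSub n (d + 2) := by
        by_contra h1; exact h.1 (eq_top_of_not_le hn h1)
      exact kerSub_ne_top hn d (h.2 _ (lt_of_le_of_ne h1 hne))
    · rw [h]; exact (kerSub_covBy_top hn d).isCoatom
  rw [SuperModule.radical, this, sInf_singleton]

theorem xiTop_mem_kerSub : xiTop n ∈ subspace (kerSub n n) := by
  rw [subspace_kerSub]; exact ⟨xiTop_mem, contr_xiTop⟩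

/-- The kernel exceeds the image by at most the line of `ξ₁ ⋯ ξₙ`, so no submodule fits strictly
between them. -/
theorem kerSub_le_of_imSub_lt (hn : 1 ≤ n) {d : ℕ} (hd : d + 2 = n)
    {N : SuperModule.Sub (symPower n (d + 2))} (h : imSub n (d + 2) < N) :
    kerSub n (d + 2) ≤ N := by
  by_cases hN : N ≤ kerSub n (d + 2)
  · subst hd
    have hW := subspace_le_subspace.2 h.le
    obtain ⟨f, hf, hfW⟩ := SetLike.not_le_iff_exists.1
      (mt subspace_le_subspace.1 h.not_ge)
    have hfK := subspace_le_subspace.2 hN hf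
    rw [subspace_kerSub] at hfK
    obtain ⟨w, hw, x, hx, rfl⟩ := Submodule.mem_sup.1 (ker_contr_le hfK)
    obtain ⟨c, rfl⟩ := Submodule.mem_span_singleton.1 hx
    rw [← subspace_imSub] at hw
    have hc : c ≠ 0 := by
      rintro rfl; exact hfW (by rwa [zero_smul, add_zero])
    have hx2 := (Submodule.smul_mem_iff _ hc).1 ((Submodule.add_mem_iff_right _ (hW hw)).1 hf)
    rw [← subspace_le_subspace, subspace_kerSub]
    refine ker_contr_le.trans (sup_le (by rwa [← subspace_imSub]) ?_)
    rwa [Submodule.span_singleton_le_iff_mem]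
  · exact kerSub_le_of_not_le hn hN

theorem imSub_lt_kerSub : imSub n n < kerSub n n :=
  lt_of_le_of_ne (imSub_le_kerSub n) fun h => by
    have := xiTop_mem_kerSub (n := n)
    rw [← h, subspace_imSub] at this
    exact xiTop_notMem this

theorem imSub_covBy_kerSub (hn : 1 ≤ n) {d : ℕ} (hd : d + 2 = n) :
    imSub n (d + 2) ⋖ kerSub n (d + 2) :=
  ⟨by subst hd; exact imSub_lt_kerSub, fun _ h1 h2 => h2.not_ge (kerSub_le_of_imSub_lt hn hd h1)⟩

theorem eq_kerSub_of_imSub_covBy (hn : 1 ≤ n) {d : ℕ} (hd : d + 2 = n)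
    {N : SuperModule.Sub (symPower n (d + 2))} (h : imSub n (d + 2) ⋖ N) :
    N = kerSub n (d + 2) := by
  rcases h.eq_or_eq (imSub_le_kerSub _) (kerSub_le_of_imSub_lt hn hd h.lt) with h1 | h1
  · exact absurd h1 (imSub_covBy_kerSub hn hd).ne'
  · exact h1.symm

end SymPower

/-! ### Identification of the layers and of the socle series. -/

section Layers

variable {n : ℕ}

instance (d : ℕ) : FiniteDimensional ℂ (symPower n d).carrier :=
  inferInstanceAs (FiniteDimensional ℂ (symDeg n d))

theorem matAct_cartan_single (i : Fin n) (f : SymAlg n) :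
    matAct n (cartan n (Pi.single i 1)).1 f = opA i i f := by
  rw [matAct_cartan, sum_eq_single i]
  · simp
  · intro j _ hj; simp [hj]
  · simp

/-- A criterion for a subquotient `N / K` of `S^d V` to be isomorphic to `Π^k L(μ)`, where `f` is
a representative of a highest weight vector. -/
theorem isShiftedL_subquotient {d k : ℕ} {μ : Fin n → ℂ} {K N : SuperModule.Sub (symPower n d)}
    (hKN : K ⋖ N) {f : SymAlg n} (hfN : f ∈ subspace N) (hfK : f ∉ subspace K)
    (hpar : invol n f = koszul k 1 • f) (hwt : ∀ i, opA i i f = μ i • f)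
    (hmax : ∀ (ν : Fin n → ℂ), ∀ g ∈ subspace N, g ∉ subspace K →
      (∀ i, opA i i g - ν i • g ∈ subspace K) → μ - ν ∈ AddSubmonoid.closure (posRoots n)) :
    IsShiftedL k μ (SuperModule.Sub.subquotient K N) where
  finite := inferInstanceAs
    (FiniteDimensional ℂ (N.carrier ⧸ K.carrier.comap N.carrier.subtype))
  simple := SuperModule.isSimple_subquotient hKN
  vector := by
    have hf := subspace_le N hfN
    let v : N.carrier := ⟨⟨f, hf⟩, (mem_subspace hf).1 hfN⟩
    refine ⟨(K.carrier.comap N.carrier.subtype).mkQ v, fun t => ?_, ?_, fun h0 => ?_⟩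
    · have h : matAct n (cartan n t).1 f = (∑ i, μ i * t i) • f := by
        rw [matAct_cartan, sum_smul]
        exact sum_congr rfl fun i _ => by rw [hwt, smul_smul, mul_comm]
      have h2 : (⟨(symPower n d).ρ (cartan n t) v.1, N.invariant _ v.1 v.2⟩ : N.carrier) =
          (∑ i, μ i * t i) • v := Subtype.ext (Subtype.ext h)
      exact congrArg (K.carrier.comap N.carrier.subtype).mkQ h2
    · exact ⟨v, sub_eq_zero.2 hpar, rfl⟩
    · exact hfK ((mem_subspace hf).2 ((Submodule.Quotient.mk_eq_zero
        (K.carrier.comap N.carrier.subtype)).1 h0))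
  highest ν hν := by
    obtain ⟨w, hw, h0⟩ := Submodule.exists_mem_ne_zero_of_ne_bot hν
    obtain ⟨⟨⟨g, hg⟩, hgN⟩, rfl⟩ := Submodule.mkQ_surjective _ w
    refine hmax ν g ((mem_subspace hg).2 hgN) (fun hgK => h0 ?_) fun i => ?_
    · exact (Submodule.Quotient.mk_eq_zero (K.carrier.comap N.carrier.subtype)).2
        ((mem_subspace hg).1 hgK)
    -- Evaluating the weight condition on the coordinate elements of the Cartan subalgebra recovers
    -- the individual `ν i`, modulo `K`.
    · have h1 := hw (Pi.single i 1)
      have h2 : ∑ j, ν j * (Pi.single i 1 : Fin n → ℂ) j = ν i := by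
        rw [sum_eq_single i]
        · simp
        · intro j _ hj; simp [hj]
        · simp
      rw [h2] at h1
      have h3 := (Submodule.Quotient.eq (K.carrier.comap N.carrier.subtype)).1 h1
      have h4 : matAct n (cartan n (Pi.single i 1)).1 g - ν i • g ∈ subspace K := ⟨_, h3, rfl⟩
      rwa [matAct_cartan_single] at h4

theorem invol_mon (a : Fin n →₀ ℕ) (L : List (Fin n)) :
    invol n (mon a L) = koszul L.length 1 • mon a L := by
  induction L with
  | nil => simp [mon, invol, mapEnd_tm, koszul]
  | cons i L ih =>
    rw [← gen_inr_mul_mon, invol_gen_mul, ih, mul_smul_comm, smul_smul, List.length_cons,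
      Nat.cast_add, add_comm (L.length : ZMod 2), koszul_add_left]
    simp [par]

theorem isShiftedL_imSub (hn : 1 ≤ n) (d : ℕ) :
    IsShiftedL 0 ((d : ℂ) • eps (⟨0, hn⟩ : Fin n))
      (SuperModule.Sub.subquotient ⊥ (imSub n d)) := by
  refine isShiftedL_subquotient (bot_covBy_imSub hn d)
    (f := mon (Finsupp.single ⟨0, hn⟩ d) []) ?_ ?_ ?_ (fun i => ?_) fun ν g hg h0 h => ?_
  · rw [subspace_imSub]; exact mon_single_mem_map_contr _ d
  · rw [subspace_bot]; exact mon_nil_ne_zero _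
  · rw [invol_mon]; simp
  · rw [opA_self_mon]
    by_cases hi : i = ⟨0, hn⟩
    · subst hi; simp [eps]
    · simp [eps, hi]
  · simp only [subspace_bot, Submodule.mem_bot, sub_eq_zero] at h0 h
    exact weight_mem_closure hn (subspace_le _ hg) h0 h

/-- The contraction embeds this quotient into `S^d V`, so a weight vector modulo the kernel becomes
a genuine weight vector there and the bound on weights applies. The representative `x₁^{d+1} ξ₁` is
odd, which accounts for the parity shift. -/
theorem isShiftedL_top (hn : 1 ≤ n) (d : ℕ) :
    IsShiftedL 1 ((d : ℂ) • eps (⟨0, hn⟩ : Fin n))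
      (SuperModule.Sub.subquotient (kerSub n (d + 2)) ⊤) := by
  refine isShiftedL_subquotient (kerSub_covBy_top hn d)
    (f := mon (Finsupp.single ⟨0, hn⟩ (d + 1)) [⟨0, hn⟩]) ?_ ?_ ?_ (fun i => ?_)
    fun ν g hg h0 h => ?_
  · rw [subspace_top]; exact mon_mem (by simp)
  · rw [subspace_kerSub]
    intro h
    have h2 := LinearMap.mem_ker.1 h.2
    rw [contr_mon_single] at h2
    exact (smul_eq_zero.1 h2).elim (Nat.cast_add_one_ne_zero d) (mon_nil_ne_zero _)
  · rw [invol_mon]; simp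
  · rw [opA_self_mon]
    by_cases hi : i = ⟨0, hn⟩
    · subst hi; simp [eps]
    · simp [eps, hi, Ne.symm hi]
  · rw [subspace_top] at hg
    rw [subspace_kerSub] at h0 h
    refine weight_mem_closure hn (contr_mem (d + 2) hg) (fun h1 => h0 ⟨hg, h1⟩) fun i => ?_
    have := LinearMap.mem_ker.1 (h i).2
    rwa [map_sub, contr_opA, map_smul, sub_eq_zero] at this

/-- The layer is the line of `ξ₁ ⋯ ξₙ`, so `-ω` is its only weight; the parity is that of `n` odd
factors. -/
theorem isShiftedL_middle (hn : 1 ≤ n) {d : ℕ} (hd : d + 2 = n) :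
    IsShiftedL n (-∑ i : Fin n, eps i)
      (SuperModule.Sub.subquotient (imSub n (d + 2)) (kerSub n (d + 2))) := by
  have hcov := imSub_covBy_kerSub hn hd
  subst hd
  have hwt : ∀ i, opA i i (xiTop (d + 2)) = -xiTop (d + 2) := fun i => by
    rw [xiTop, opA_self_mon, List.count_eq_one_of_mem (List.nodup_finRange _) (List.mem_finRange i)]
    simp
  have hsum : ∀ i : Fin (d + 2), (-∑ j : Fin (d + 2), eps j) i = -1 := fun i => by
    simp [eps, Finset.sum_apply, Pi.single_apply]
  refine isShiftedL_subquotient hcov (f := xiTop (d + 2)) xiTop_mem_kerSub ?_ ?_ (fun i => ?_)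
    fun ν g hg h0 h => ?_
  · rw [subspace_imSub]; exact xiTop_notMem
  · rw [xiTop, invol_mon, List.length_finRange]
  · rw [hwt, hsum]; simp
  · have : ν = -∑ j : Fin (d + 2), eps j := by
      ext i
      rw [hsum]
      rw [subspace_kerSub] at hg
      obtain ⟨w, hw, x, hx, rfl⟩ := Submodule.mem_sup.1 (ker_contr_le hg)
      obtain ⟨c, rfl⟩ := Submodule.mem_span_singleton.1 hx
      rw [← subspace_imSub] at hw
      have hc : c ≠ 0 := by
        rintro rfl; exact h0 (by rwa [zero_smul, add_zero])
      by_contra hν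
      have h1 := h i
      -- Subtracting the contribution of `w`, which lies in the invariant image, isolates the
      -- multiple of `ξ₁ ⋯ ξₙ`; its coefficient must vanish because that vector is not in the image.
      have h2 : (-1 - ν i) • c • xiTop (d + 2) ∈ subspace (imSub (d + 2) (d + 2)) := by
        have h3 := sub_mem h1 (sub_mem ((invariant_subspace _).opA i i w hw)
          (Submodule.smul_mem _ (ν i) hw))
        convert h3 using 1
        rw [map_add, map_smul, hwt]
        module
      have h3 := (Submodule.smul_mem_iff _ hc).1
        ((Submodule.smul_mem_iff _ (sub_ne_zero.2 (Ne.symm hν))).1 h2)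
      rw [subspace_imSub] at h3
      exact xiTop_notMem h3
    rw [this, sub_self]
    exact zero_mem _

theorem socleSeries_one (hn : 1 ≤ n) (d : ℕ) : (symPower n d).socleSeries 1 = imSub n d :=
  SuperModule.socleSeries_succ_of_covBy (k := 0) rfl (bot_covBy_imSub hn d)
    fun _ h => eq_imSub_of_bot_covBy hn h

theorem socleSeries_two_of_ne (hn : 1 ≤ n) {d : ℕ} (hd : d + 2 ≠ n) :
    (symPower n (d + 2)).socleSeries 2 = ⊤ :=
  SuperModule.socleSeries_succ_of_covBy (k := 1)
    ((socleSeries_one hn _).trans (imSub_eq_kerSub hd)) (kerSub_covBy_top hn d)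
    fun _ h => eq_top_of_kerSub_covBy hn h

theorem socleSeries_two_of_eq (hn : 1 ≤ n) {d : ℕ} (hd : d + 2 = n) :
    (symPower n (d + 2)).socleSeries 2 = kerSub n (d + 2) :=
  SuperModule.socleSeries_succ_of_covBy (k := 1) (socleSeries_one hn _)
    (imSub_covBy_kerSub hn hd) fun _ h => eq_kerSub_of_imSub_covBy hn hd h

theorem socleSeries_three_of_eq (hn : 1 ≤ n) {d : ℕ} (hd : d + 2 = n) :
    (symPower n (d + 2)).socleSeries 3 = ⊤ :=
  SuperModule.socleSeries_succ_of_covBy (k := 2) (socleSeries_two_of_eq hn hd)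
    (kerSub_covBy_top hn d) fun _ h => eq_top_of_kerSub_covBy hn h

/-! ### The symmetric powers of degree zero and one. -/

theorem symPower_zero_isomorphic :
    (symPower n 0).Isomorphic (SuperModule.trivialModule (periplectic n)) := by
  refine SuperModule.Isomorphic.symm ?_
  let φ : ℂ →ₗ[ℂ] symDeg n 0 := LinearMap.toSpanSingleton ℂ _
    ⟨1, by rw [symDeg_zero]; exact Submodule.mem_span_singleton_self _⟩
  have hφ : ∀ c, (φ c : SymAlg n) = c • 1 := fun c => rfl
  have hpar : ∀ (i : ZMod 2) (c : ℂ), c ∈ (if i = 0 then ⊤ else ⊥ : Submodule ℂ ℂ) →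
      invol n (φ c) - koszul i 1 • (φ c : SymAlg n) = 0 := fun i c hc => by
    rw [hφ, map_smul, invol_one]
    by_cases hi : i = 0
    · simp [hi, koszul]
    · rw [if_neg hi, Submodule.mem_bot] at hc
      simp [hc]
  have hact : ∀ (X : Mat n) (c : ℂ), (φ 0 : SymAlg n) = matAct n X (φ c) := fun X c => by
    rw [hφ, hφ, matAct_apply]
    simp [der_one]
  refine ⟨LinearEquiv.ofBijective φ ⟨?_, ?_⟩, hpar, fun X c => Subtype.ext (hact X.1 c)⟩
  · rw [injective_iff_map_eq_zero]
    intro c hc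
    have := congrArg Subtype.val hc
    rw [hφ] at this
    exact (smul_eq_zero.1 this).resolve_right one_ne_zero
  · rintro ⟨f, hf⟩
    have h := hf
    rw [symDeg_zero] at h
    obtain ⟨c, rfl⟩ := Submodule.mem_span_singleton.1 h
    exact ⟨c, Subtype.ext (hφ c)⟩

theorem symPower_one_isomorphic : (symPower n 1).Isomorphic (standardModule n) := by
  refine SuperModule.Isomorphic.symm ?_
  have hmem : ∀ a, gen n a ∈ symDeg n 1 := fun a => by
    rw [symDeg, pow_one]; exact Submodule.subset_span ⟨a, rfl⟩
  let φ : (Fin n ⊕ Fin n → ℂ) →ₗ[ℂ] symDeg n 1 :=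
    Fintype.linearCombination ℂ fun a => (⟨gen n a, hmem a⟩ : symDeg n 1)
  have hφ : ∀ v, (φ v : SymAlg n) = ∑ a, v a • gen n a := fun v => by
    simp [φ, Fintype.linearCombination_apply]
  -- The derivations read off the coordinates of `v`; this gives both injectivity and equivariance
  -- of `φ`.
  have hder : ∀ v b, der n b (φ v) = v b • 1 := fun v b => by
    have h : ∀ a, der n b (gen n a) = (if b = a then (1 : ℂ) else 0) • 1 := fun a => by
      have := der_gen_mul a b 1
      rwa [mul_one, der_one, mul_zero, smul_zero, add_zero] at this
    rw [hφ, map_sum]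
    simp [h]
  have hpar : ∀ (i : ZMod 2) (v : Fin n ⊕ Fin n → ℂ), (∀ a, par a ≠ i → v a = 0) →
      invol n (φ v) - koszul i 1 • (φ v : SymAlg n) = 0 := fun i v hv => by
    rw [hφ, map_sum, smul_sum, ← sum_sub_distrib]
    refine sum_eq_zero fun a _ => ?_
    by_cases ha : par a = i
    · have := invol_gen_mul a (1 : SymAlg n)
      rw [mul_one, invol_one, mul_one] at this
      rw [map_smul, this, ha, smul_comm, sub_self]
    · rw [hv a ha, zero_smul, map_zero, smul_zero, sub_self]
  have hact : ∀ (X : Mat n) (v : Fin n ⊕ Fin n → ℂ),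
      (φ (Matrix.toLin' X v) : SymAlg n) = matAct n X (φ v) := fun X v => by
    rw [hφ, matAct_apply]
    refine sum_congr rfl fun a _ => ?_
    rw [Matrix.toLin'_apply, Matrix.mulVec, dotProduct, sum_smul]
    refine sum_congr rfl fun b _ => ?_
    rw [hder, mul_smul_comm, mul_one, smul_smul]
  refine ⟨LinearEquiv.ofBijective φ ⟨?_, ?_⟩, hpar, fun X v => Subtype.ext (hact X.1 v)⟩
  · rw [injective_iff_map_eq_zero]
    intro v hv
    ext b
    have := hder v b
    rw [hv, ZeroMemClass.coe_zero, map_zero] at this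
    exact (smul_eq_zero.1 this.symm).resolve_right one_ne_zero
  · rintro ⟨f, hf⟩
    have h := hf
    rw [symDeg, pow_one] at h
    obtain ⟨v, hv⟩ := (Submodule.mem_span_range_iff_exists_fun ℂ).1 h
    exact ⟨v, Subtype.ext ((hφ v).trans hv)⟩

end Layers

end SuperLie

/-! ### Assembly, with the degree written as `d + 2`. -/

theorem mainTheorem7 (n : ℕ) (hn : 1 ≤ n) :
    (SuperLie.symPower n 0).Isomorphic (SuperLie.SuperModule.trivialModule (SuperLie.periplectic n)) ∧
    (SuperLie.symPower n 1).Isomorphic (SuperLie.standardModule n) ∧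
    ∀ d : ℕ, 2 ≤ d →
      (d ≠ n →
        (SuperLie.symPower n d).socleSeries 2 = ⊤ ∧
        SuperLie.IsoShiftL 0 ((d : ℂ) • SuperLie.eps (⟨0, hn⟩ : Fin n))
          ((SuperLie.symPower n d).socleLayer 0) ∧
        SuperLie.IsoShiftL 1 (((d : ℂ) - 2) • SuperLie.eps (⟨0, hn⟩ : Fin n))
          ((SuperLie.symPower n d).socleLayer 1)) ∧
      (d = n →
        (SuperLie.symPower n d).socleSeries 3 = ⊤ ∧
        SuperLie.IsoShiftL 0 ((n : ℂ) • SuperLie.eps (⟨0, hn⟩ : Fin n))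
          ((SuperLie.symPower n d).socleLayer 0) ∧
        SuperLie.IsoShiftL n (-∑ i : Fin n, SuperLie.eps i)
          ((SuperLie.symPower n d).socleLayer 1) ∧
        SuperLie.IsoShiftL 1 (((n : ℂ) - 2) • SuperLie.eps (⟨0, hn⟩ : Fin n))
          ((SuperLie.symPower n d).socleLayer 2)) ∧
      (SuperLie.symPower n d).radical.carrier = LinearMap.ker (SuperLie.oddContraction n d) ∧
      SuperLie.IsoShiftL 1 (((d : ℂ) - 2) • SuperLie.eps (⟨0, hn⟩ : Fin n))
        (SuperLie.symPower n d).head := by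
  open SuperLie in
  refine ⟨symPower_zero_isomorphic, symPower_one_isomorphic, fun d hd => ?_⟩
  obtain ⟨d, rfl⟩ := Nat.exists_eq_add_of_le' hd
  have hcast : ((d + 2 : ℕ) : ℂ) - 2 = d := by push_cast; ring
  have hbot : (symPower n (d + 2)).socleSeries 0 = ⊥ := rfl
  have hsoc : IsoShiftL 0 (((d + 2 : ℕ) : ℂ) • eps (⟨0, hn⟩ : Fin n))
      ((symPower n (d + 2)).socleLayer 0) := by
    rw [SuperModule.socleLayer, hbot, socleSeries_one hn]
    exact (isShiftedL_imSub hn (d + 2)).isoShiftL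
  have htop := (isShiftedL_top hn d).isoShiftL
  refine ⟨fun h => ⟨socleSeries_two_of_ne hn h, hsoc, ?_⟩, fun h => ⟨socleSeries_three_of_eq hn h,
    by subst h; exact hsoc, ?_, ?_⟩, ?_, ?_⟩
  · rw [hcast, SuperModule.socleLayer, socleSeries_two_of_ne hn h, socleSeries_one hn,
      imSub_eq_kerSub h]
    exact htop
  · rw [SuperModule.socleLayer, socleSeries_two_of_eq hn h, socleSeries_one hn]
    exact (isShiftedL_middle hn h).isoShiftL
  · rw [SuperModule.socleLayer, socleSeries_two_of_eq hn h, socleSeries_three_of_eq hn h]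
    have h2 : (n : ℂ) - 2 = d := by rw [← h]; exact hcast
    rw [h2]
    exact htop
  · rw [radical_eq hn, kerSub_carrier]
  · rw [hcast, SuperModule.head, radical_eq hn]
    exact htop
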